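/- Let $c>0$ and, for $n\in\mathbb N$, $k\in\mathbb N_0$, put $$p_{n,k}(x)=\frac{(n/c)_k\,(cx)^k}{k!\,(1+cx)^{n/c+k}},\qquad \theta_{n,k}(t)=\frac{n e^{-nt}(nt)^k}{k!},\qquad (y)_k=\prod_{i=0}^{k-1}(y+i),$$ and $$L_{n,c}(f,x)=\sum_{k=0}^\infty p_{n,k}(x)\int_0^\infty\theta_{n,k}(t)f(t)\,dt .$$ Let $r\in\mathbb N_0$ and $[a_1,b_1]\subset(a,b)\subset(0,\infty)$ with $a,b$ finite. There are $C>0$ and $N\in\mathbb N$, depending only on $c,r,a,b,a_1,b_1$, such that for every bounded measurable $f:[0,\infty)\to\mathbb R$ for which $f^{(r)}$ exists and is continuous on $[a,b]$ (with one-sided derivatives at the end points), and every $n\ge N$, the integrals and the series defining $L_{n,c}(f,x)$ converge for $x\ge 0$, $L_{n,c}(f,\cdot)$ is $r$ times continuously differentiable on $(0,\infty)$, and $$\big\|L_{n,c}^{(r)}(f,\cdot)-f^{(r)}\big\|_{[a_1,b_1]}\le C\left(n^{-1}\|f\|+\omega_2\big(f^{(r)};n^{-1/2};[a,b]\big)\right).$$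 Here $\|g\|_{[a_1,b_1]}=\sup_{x\in[a_1,b_1]}|g(x)|$, $\|f\|=\sup_{t\ge0}|f(t)|$, and $$\omega_2(g;\delta;[a,b])=\sup\{|g(x+2h)-2g(x+h)+g(x)| : 0\le h\le\delta,\ x,\,x+2h\in[a,b]\}.$$ -/

import Mathlib

open Set MeasureTheory

noncomputable section

namespace HybridOp

/-- The rising factorial `(y)_k = y (y + 1) ⋯ (y + k - 1)` of a real number `y`. -/
def rising (y : ℝ) (k : ℕ) : ℝ := ∏ i ∈ Finset.range k, (y + (i : ℝ))

/-- The Baskakov-type weight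
`p_{n,k}(x) = (n/c)_k (c x)^k / (k! (1 + c x)^{n/c + k})`. -/
def p (c : ℝ) (n k : ℕ) (x : ℝ) : ℝ :=
  rising ((n : ℝ) / c) k * (c * x) ^ k /
    ((k.factorial : ℝ) * (c * x + 1) ^ ((n : ℝ) / c + (k : ℝ)))

/-- The Szász-type kernel `θ_{n,k}(t) = n e^{-n t} (n t)^k / k!`. -/
def θ (n k : ℕ) (t : ℝ) : ℝ :=
  (n : ℝ) * Real.exp (-((n : ℝ) * t)) * ((n : ℝ) * t) ^ k / (k.factorial : ℝ)

/-- The operator `L_{n,c} f (x) = ∑_{k ≥ 0} p_{n,k}(x) ∫_0^∞ θ_{n,k}(t) f(t) dt`. -/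
def L (c : ℝ) (n : ℕ) (f : ℝ → ℝ) (x : ℝ) : ℝ :=
  ∑' k : ℕ, p c n k x * ∫ t in Ioi (0 : ℝ), θ n k t * f t

/-- The supremum norm of `g` on the set `S` (used only for `g` bounded on `S`). -/
def supNorm (S : Set ℝ) (g : ℝ → ℝ) : ℝ := sSup ((fun x => |g x|) '' S)

/-- The second modulus of smoothness `ω₂(g; δ; [a,b])`: the supremum of
`|g(x + 2h) - 2 g(x + h) + g(x)|` over `0 ≤ h ≤ δ` and `x` with `x, x + 2h ∈ [a,b]`. -/
def omega2 (g : ℝ → ℝ) (δ a b : ℝ) : ℝ :=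
  sSup {y : ℝ | ∃ h x : ℝ, 0 ≤ h ∧ h ≤ δ ∧ x ∈ Icc a b ∧ x + 2 * h ∈ Icc a b ∧
    y = |g (x + 2 * h) - 2 * g (x + h) + g x|}

end HybridOp

end

/-!
The operator is a mixture: `p_{n,k}(x)` is a negative binomial law in `k`, and `θ_{n,k}` is a Gamma
density in `t`. Writing `wt c S k x` for the weight with `n / c` replaced by `S`, one has
`(wt c S k)' = c S (wt c (S+1) (k-1) - wt c (S+1) k)`, so that differentiating `r` times turns the
coefficients `A_k(f) = ∫ θ_{n,k} f` into their forward differences and `S = n / c` into `n / c + r`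
(`iteratedDeriv_wtSum`):
`L^{(r)}(f, x) = c^r (n/c)_r ∑ wt c (n/c + r) k x · Δ^r A_k(f)`.

For a `C^r` function `F` of moderate growth, integration by parts gives
`Δ^r A_k(F) = n^{-r} A_{k+r}(F^{(r)})` (`fwdDiff_iterate_szaszCoef`). The given `f` is smooth on
`[a, b]` only, so it is compared with an extension `F` of its restriction to `[a, b]`, chosen with
`F^{(r)}` constant off `[a, b]` (`exists_contDiff_extension`). The difference `f - F` vanishes on
`[a, b]` and grows at most exponentially; a Chernoff bound, from the explicit exponential moments
of the two laws, makes its contribution on `[a₁, b₁]` exponentially small in `n`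
(`exists_abs_wtSum_fwdDiff_le_exp_neg`), which absorbs the factor `n^r`.

For the main part, put `g = f^{(r)}` and `ω = ω₂(g; n^{-1/2})`. No smoothing of `g` is needed: at
each `x` there is an affine function `ℓ` with `ℓ(x) = g(x)` and `|g(t) - ℓ(t)| ≤ 4 ω (1 + n (t - x)²)`
(`exists_slope_abs_sub_le`). As the mean and the variance of the law about `x` are `O(1/n)`, the
error is `O(ω + (|g(x)| + |ℓ'|) / n)` (`exists_abs_wtSum_szaszCoef_sub_le`). Finally `|g(x)|` and
`|ℓ'|` are `O(‖f‖ + n ω)`, because a bounded function has a point with a small `r`-th derivative in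
each of two separated subintervals (`exists_abs_affine_coeff_le`).
-/

namespace HybridOp

/-! ### The negative binomial weights -/

theorem rising_succ_left (S : ℝ) (k : ℕ) : rising S (k + 1) = S * rising (S + 1) k := by
  unfold rising
  rw [Finset.prod_range_succ', mul_comm]
  congr 1
  · simp
  · exact Finset.prod_congr rfl fun i _ => by push_cast; ring

theorem rising_succ_right (S : ℝ) (k : ℕ) : rising S (k + 1) = rising S k * (S + k) := by
  unfold rising
  rw [Finset.prod_range_succ]

theorem rising_zero (S : ℝ) : rising S 0 = 1 := by simp [rising]

theorem rising_nonneg {S : ℝ} (hS : 0 ≤ S) (k : ℕ) : 0 ≤ rising S k :=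
  Finset.prod_nonneg fun i _ => by positivity

theorem choose_eq_rising_div (S : ℝ) (k : ℕ) :
    Ring.choose (S + k - 1) k = rising S k / k.factorial := by
  have h1 : Ring.choose (S + k - 1) k = Ring.multichoose S k := by
    rw [Ring.choose]; congr 1; ring
  have h2 := Ring.factorial_nsmul_multichoose_eq_ascPochhammer S k
  rw [h1, eq_div_iff (by positivity), mul_comm, ← nsmul_eq_mul, h2]
  induction k with
  | zero => simp [rising_zero]
  | succ k ih =>
    rw [rising_succ_right, ← ih (by rw [Ring.choose]; congr 1; ring)
      (Ring.factorial_nsmul_multichoose_eq_ascPochhammer S k), ascPochhammer_succ_right,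
      Polynomial.smeval_mul, Polynomial.smeval_add, Polynomial.smeval_X, Polynomial.smeval_natCast]
    simp

/-- The binomial series of `(1 - z)^{-S}` with real exponent. -/
theorem hasSum_rising_mul_pow (S : ℝ) {z : ℝ} (hz : |z| < 1) :
    HasSum (fun k : ℕ => rising S k / k.factorial * z ^ k) ((1 - z) ^ (-S)) := by
  have h := (Real.one_div_one_sub_rpow_hasFPowerSeriesOnBall_zero S).hasSum
    (y := z) (by simpa [Real.enorm_eq_ofReal_abs] using hz)
  simp only [FormalMultilinearSeries.ofScalars_apply_eq, choose_eq_rising_div, smul_eq_mul,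
    zero_add] at h
  rwa [Real.rpow_neg (by linarith [abs_lt.1 hz]), ← one_div]

/-- The weight `p_{n,k}` with the ratio `n / c` replaced by an arbitrary real parameter `S`.
Differentiation raises `S` by one, so all the derivatives of `L` are sums over these weights. -/
noncomputable def wt (c S : ℝ) (k : ℕ) (x : ℝ) : ℝ :=
  rising S k * (c * x) ^ k / ((k.factorial : ℝ) * (c * x + 1) ^ (S + (k : ℝ)))

theorem wt_eq {c x : ℝ} (h : 0 < c * x + 1) (S : ℝ) (k : ℕ) :
    wt c S k x =
      rising S k / k.factorial * (c * x / (c * x + 1)) ^ k * (c * x + 1) ^ (-S) := by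
  unfold wt
  rw [Real.rpow_add h, Real.rpow_natCast, Real.rpow_neg h.le, div_pow]
  have := Real.rpow_pos_of_pos h S
  field_simp

theorem wt_nonneg {c S x : ℝ} (hc : 0 < c) (hS : 0 ≤ S) (hx : 0 ≤ x) (k : ℕ) :
    0 ≤ wt c S k x := by
  unfold wt
  have := rising_nonneg hS k
  positivity

/-- The generating function of the weights; `w = 1` gives total mass one, and other values of `w`
give the exponential moments of the Chernoff bound. -/
theorem hasSum_wt_mul_pow {c S x w : ℝ} (hc : 0 < c) (hx : 0 ≤ x) (hw : 0 ≤ w)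
    (h : 0 < c * x + 1 - c * x * w) :
    HasSum (fun k => wt c S k x * w ^ k) ((c * x + 1 - c * x * w) ^ (-S)) := by
  have h0 : 0 < c * x + 1 := by positivity
  have hz : |c * x / (c * x + 1) * w| < 1 := by
    rw [abs_of_nonneg (by positivity), div_mul_eq_mul_div, div_lt_one h0]
    linarith
  convert! (hasSum_rising_mul_pow S hz).mul_right ((c * x + 1) ^ (-S)) using 1
  · ext k
    rw [wt_eq h0, mul_pow]; ring
  · rw [← Real.mul_rpow (by linarith [abs_lt.1 hz]) h0.le]
    congr 1
    field_simp

theorem hasSum_wt {c x : ℝ} (S : ℝ) (hc : 0 < c) (hx : 0 ≤ x) :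
    HasSum (fun k => wt c S k x) 1 := by
  simpa using hasSum_wt_mul_pow (S := S) (w := 1) hc hx zero_le_one (by simp)

/-- Weighting by the index raises the parameter, which yields the factorial moments. -/
theorem succ_mul_wt_succ {c x : ℝ} (S : ℝ) (k : ℕ) :
    ((k : ℝ) + 1) * wt c S (k + 1) x = S * (c * x) * wt c (S + 1) k x := by
  unfold wt
  rw [rising_succ_left, Nat.factorial_succ]
  have : S + ((k + 1 : ℕ) : ℝ) = S + 1 + k := by push_cast; ring
  rw [this]
  push_cast
  have h1 : (k : ℝ) + 1 ≠ 0 := by positivity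
  have h2 : (k.factorial : ℝ) ≠ 0 := by positivity
  rw [mul_assoc ((k : ℝ) + 1), ← mul_div_assoc, mul_div_mul_left _ _ h1]
  ring

theorem hasSum_nat_mul_wt {c x : ℝ} (S : ℝ) (hc : 0 < c) (hx : 0 ≤ x) :
    HasSum (fun k : ℕ => (k : ℝ) * wt c S k x) (S * (c * x)) := by
  rw [← hasSum_nat_add_iff' 1]
  simpa [succ_mul_wt_succ] using (hasSum_wt (S + 1) hc hx).mul_left (S * (c * x))

theorem hasSum_nat_sq_mul_wt {c x : ℝ} (S : ℝ) (hc : 0 < c) (hx : 0 ≤ x) :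
    HasSum (fun k : ℕ => (k : ℝ) ^ 2 * wt c S k x)
      (S * (S + 1) * (c * x) ^ 2 + S * (c * x)) := by
  rw [← hasSum_nat_add_iff' 1]
  have h := ((hasSum_nat_mul_wt (S + 1) hc hx).add (hasSum_wt (S + 1) hc hx)).mul_left
    (S * (c * x))
  convert! h using 1
  · ext k
    have := succ_mul_wt_succ (c := c) (x := x) S k
    push_cast
    linear_combination ((k : ℝ) + 1) * this
  · simp; ring

/-- `wt c S (k - 1)`, with the convention that the weight of index `-1` vanishes. -/
noncomputable def wtPred (c S : ℝ) (k : ℕ) (x : ℝ) : ℝ :=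
  k.casesOn 0 fun j => wt c S j x

theorem hasDerivAt_wt {c x : ℝ} (S : ℝ) (h : 0 < c * x + 1) (k : ℕ) :
    HasDerivAt (wt c S k) (c * S * (wtPred c (S + 1) k x - wt c (S + 1) k x)) x := by
  have hlin : HasDerivAt (fun y : ℝ => c * y) c x := by
    simpa using (hasDerivAt_id x).const_mul c
  have hden := (hlin.add_const 1).rpow_const (p := -(S + k)) (Or.inl h.ne')
  have hnum := hlin.fun_pow k
  have heq : wt c S k =ᶠ[nhds x] fun y =>
      rising S k / k.factorial * ((c * y) ^ k * (c * y + 1) ^ (-(S + (k : ℝ)))) := by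
    have : ∀ᶠ y in nhds x, 0 < c * y + 1 :=
      (by fun_prop : Continuous fun y : ℝ => c * y + 1).continuousAt.eventually_const_lt h
    filter_upwards [this] with y hy
    rw [Real.rpow_neg hy.le, wt]
    have := Real.rpow_pos_of_pos hy (S + k)
    field_simp
  refine (((hnum.mul hden).const_mul _).congr_of_eventuallyEq heq).congr_deriv ?_
  have hk1 : (c * x + 1) ^ (-(S + (k : ℝ))) = (c * x + 1) * (c * x + 1) ^ (-(S + (k : ℝ)) - 1) := by
    rw [Real.rpow_sub_one h.ne']; field_simp
  have hQ : ∀ j : ℕ, wt c (S + 1) j x = rising (S + 1) j / j.factorial * (c * x) ^ j *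
      (c * x + 1) ^ (-(S + (j : ℝ)) - 1) := by
    intro j
    rw [show -(S + (j : ℝ)) - 1 = -(S + 1 + j) by ring, Real.rpow_neg h.le, wt]
    have := Real.rpow_pos_of_pos h (S + 1 + j)
    field_simp
  have hS : S * rising (S + 1) k = rising S k * (S + k) := by
    rw [← rising_succ_left, rising_succ_right]
  rw [hQ k]
  cases k with
  | zero =>
    simp [wtPred, rising_zero]
  | succ k =>
    simp only [wtPred]
    rw [hQ k]
    have e : (c * x + 1) ^ (-(S + (k : ℝ)) - 1) =
      (c * x + 1) * (c * x + 1) ^ (-(S + ((k + 1 : ℕ) : ℝ)) - 1) := by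
      rw [Real.rpow_sub_one h.ne' (-(S + ((k + 1 : ℕ) : ℝ)))]
      push_cast
      rw [show -(S + ((k : ℝ) + 1)) = -(S + (k : ℝ)) - 1 by ring]
      field_simp
    rw [hk1, e]
    rw [Nat.factorial_succ]
    set B := (c * x + 1) ^ (-(S + ((k + 1 : ℕ) : ℝ)) - 1)
    have h1 : (k : ℝ) + 1 ≠ 0 := by positivity
    have h2 : (k.factorial : ℝ) ≠ 0 := by positivity
    have hR := rising_succ_left S k
    push_cast at hS ⊢
    field_simp
    linear_combination c * (c * x) ^ k * B * ((c * x) * hS + ((k : ℝ) + 1) * (c * x + 1) * hR)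

/-! ### Sums against the weights and their derivatives -/

/-- The sum of the sequence `A` against the weights `wt c S`; it is `0` if the series diverges. -/
noncomputable def wtSum (c S : ℝ) (A : ℕ → ℝ) (x : ℝ) : ℝ := ∑' k, wt c S k x * A k

theorem summable_wt_mul {c S x M : ℝ} {A : ℕ → ℝ} (hc : 0 < c) (hS : 0 ≤ S) (hx : 0 ≤ x)
    (hA : ∀ k, |A k| ≤ M) : Summable fun k => wt c S k x * A k := by
  refine Summable.of_norm_bounded ((hasSum_wt S hc hx).summable.mul_right M) fun k => ?_
  rw [norm_mul, Real.norm_eq_abs, Real.norm_eq_abs, abs_of_nonneg (wt_nonneg hc hS hx k)]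
  exact mul_le_mul_of_nonneg_left (hA k) (wt_nonneg hc hS hx k)

/-- On `[0, X]` the weights are dominated, up to a constant, by their values at `X`. -/
theorem wt_le_wt_mul {c S x X : ℝ} (hc : 0 < c) (hS : 0 ≤ S) (hx : 0 ≤ x) (hxX : x ≤ X) (k : ℕ) :
    wt c S k x ≤ wt c S k X * (c * X + 1) ^ S := by
  have h0 : 0 < c * x + 1 := by positivity
  have h1 : 0 < c * X + 1 := by have := hx.trans hxX; positivity
  have hX := Real.rpow_pos_of_pos h1 S
  rw [wt_eq h0, wt_eq h1, Real.rpow_neg h1.le, inv_mul_cancel_right₀ hX.ne']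
  have hr := rising_nonneg hS k
  have hle : (c * x + 1) ^ (-S) ≤ 1 :=
    Real.rpow_le_one_of_one_le_of_nonpos (by nlinarith) (by linarith)
  have hz : c * x / (c * x + 1) ≤ c * X / (c * X + 1) := by
    rw [div_le_div_iff₀ h0 h1]; nlinarith
  calc _ ≤ rising S k / k.factorial * (c * x / (c * x + 1)) ^ k * 1 := by gcongr
    _ ≤ _ := by rw [mul_one]; gcongr

/-- Termwise differentiation followed by summation by parts. -/
theorem hasDerivAt_wtSum {c S x M : ℝ} {A : ℕ → ℝ} (hc : 0 < c) (hS : 0 ≤ S) (hx : 0 < x)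
    (hA : ∀ k, |A k| ≤ M) :
    HasDerivAt (wtSum c S A) (c * S * wtSum c (S + 1) (fwdDiff 1 A) x) x := by
  have hM : 0 ≤ M := (abs_nonneg _).trans (hA 0)
  have hS1 : 0 ≤ S + 1 := by linarith
  set X := x + 1 with hX
  have hX0 : 0 ≤ X := by linarith
  set Q := (c * X + 1) ^ (S + 1)
  -- the termwise derivatives are dominated on `(0, X)` by a summable sequence
  let u : ℕ → ℝ := fun k => c * S * ((wtPred c (S + 1) k X * Q + wt c (S + 1) k X * Q) * M)
  have hpred : Summable fun k => wtPred c (S + 1) k X := by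
    rw [← summable_nat_add_iff 1]
    exact (hasSum_wt (S + 1) hc hX0).summable
  have hu : Summable u :=
    (((hpred.mul_right Q).add ((hasSum_wt (S + 1) hc hX0).summable.mul_right Q)).mul_right
      M).mul_left _
  have hpred_nonneg : ∀ y, 0 ≤ y → ∀ k, 0 ≤ wtPred c (S + 1) k y := by
    intro y hy k
    cases k with
    | zero => exact le_rfl
    | succ k => exact wt_nonneg hc hS1 hy k
  have hpred_le : ∀ y, 0 ≤ y → y ≤ X → ∀ k, wtPred c (S + 1) k y ≤ wtPred c (S + 1) k X * Q := by
    intro y hy hyX k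
    cases k with
    | zero => simp [wtPred]
    | succ k => exact wt_le_wt_mul hc hS1 hy hyX k
  have key := hasDerivAt_tsum_of_isPreconnected (t := Ioo 0 X) (y₀ := x) (y := x) hu isOpen_Ioo
    isPreconnected_Ioo (g := fun k y => wt c S k y * A k)
    (g' := fun k y => c * S * (wtPred c (S + 1) k y - wt c (S + 1) k y) * A k)
    (fun k y hy => (hasDerivAt_wt S (by have := hy.1; positivity) k).mul_const (A k))
    (fun k y hy => by
      have h1 := hpred_nonneg y hy.1.le k
      have h2 := wt_nonneg hc hS1 hy.1.le k
      have h3 := hpred_le y hy.1.le hy.2.le k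
      have h4 := wt_le_wt_mul hc hS1 hy.1.le hy.2.le k
      rw [Real.norm_eq_abs, abs_mul, abs_mul, abs_of_nonneg (by positivity : 0 ≤ c * S), mul_assoc]
      refine mul_le_mul_of_nonneg_left (mul_le_mul ?_ (hA k) (abs_nonneg _) ?_) (by positivity)
      · rw [abs_le]; constructor <;> linarith
      · linarith)
    ⟨hx, by linarith⟩ (summable_wt_mul hc hS hx.le hA) ⟨hx, by linarith⟩
  refine key.congr_deriv ?_
  have hs2 := summable_wt_mul (S := S + 1) hc hS1 hx.le hA
  have hs1 : Summable fun k => wtPred c (S + 1) k x * A k := by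
    rw [← summable_nat_add_iff 1]
    exact summable_wt_mul (A := fun k => A (k + 1)) hc hS1 hx.le fun k => hA (k + 1)
  have e1 : ∑' k, wtPred c (S + 1) k x * A k = ∑' k, wt c (S + 1) k x * A (k + 1) := by
    rw [hs1.tsum_eq_zero_add]; simp [wtPred]
  simp only [mul_assoc, sub_mul]
  rw [tsum_mul_left, tsum_mul_left, hs1.tsum_sub hs2, e1, wtSum, ← Summable.tsum_sub
    (summable_wt_mul (A := fun k => A (k + 1)) hc hS1 hx.le fun k => hA (k + 1)) hs2]
  simp only [fwdDiff, mul_sub]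

theorem abs_fwdDiff_le {A : ℕ → ℝ} {M : ℝ} (hA : ∀ k, |A k| ≤ M) (k : ℕ) :
    |fwdDiff 1 A k| ≤ 2 * M := by
  have := abs_sub (A (k + 1)) (A k)
  simp only [fwdDiff]
  linarith [hA k, hA (k + 1)]

theorem abs_fwdDiff_iterate_le {A : ℕ → ℝ} {M : ℝ} (hA : ∀ k, |A k| ≤ M) (r k : ℕ) :
    |(fwdDiff 1)^[r] A k| ≤ 2 ^ r * M := by
  induction r generalizing A M with
  | zero => simpa using hA k
  | succ r ih =>
    rw [Function.iterate_succ_apply, pow_succ, mul_assoc]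
    exact ih (abs_fwdDiff_le hA)

theorem contDiffOn_wtSum {c S M : ℝ} {A : ℕ → ℝ} (hc : 0 < c) (hS : 0 ≤ S)
    (hA : ∀ k, |A k| ≤ M) (r : ℕ) : ContDiffOn ℝ r (wtSum c S A) (Ioi 0) := by
  induction r generalizing S A M with
  | zero =>
    rw [Nat.cast_zero, contDiffOn_zero]
    exact fun x hx => (hasDerivAt_wtSum hc hS hx hA).continuousAt.continuousWithinAt
  | succ r ih =>
    rw [Nat.cast_succ, contDiffOn_succ_iff_deriv_of_isOpen isOpen_Ioi]
    refine ⟨fun x hx => (hasDerivAt_wtSum hc hS hx hA).differentiableAt.differentiableWithinAt,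
      by simp, ?_⟩
    exact (contDiffOn_const.mul (ih (by linarith) (abs_fwdDiff_le hA))).congr
      fun x hx => (hasDerivAt_wtSum hc hS hx hA).deriv

/-- Each differentiation raises the parameter of the weights and takes a forward difference of
the sequence. -/
theorem iteratedDeriv_wtSum {c S M : ℝ} {A : ℕ → ℝ} (hc : 0 < c) (hS : 0 ≤ S)
    (hA : ∀ k, |A k| ≤ M) (r : ℕ) {x : ℝ} (hx : 0 < x) :
    iteratedDeriv r (wtSum c S A) x =
      c ^ r * rising S r * wtSum c (S + r) ((fwdDiff 1)^[r] A) x := by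
  induction r generalizing x with
  | zero => simp [rising_zero]
  | succ r ih =>
    rw [iteratedDeriv_succ]
    have hev : iteratedDeriv r (wtSum c S A) =ᶠ[nhds x]
        fun y => c ^ r * rising S r * wtSum c (S + r) ((fwdDiff 1)^[r] A) y := by
      filter_upwards [isOpen_Ioi.mem_nhds hx] with y hy using ih hy
    rw [hev.deriv_eq, ((hasDerivAt_wtSum hc (by positivity) hx
      (abs_fwdDiff_iterate_le hA r)).const_mul _).deriv, rising_succ_right,
      Function.iterate_succ_apply']
    push_cast
    rw [← add_assoc]
    ring

/-! ### Integrals against the Szász kernel -/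

/-- The integral of `f` against the Szász kernel `θ n k`. -/
noncomputable def szaszCoef (n : ℕ) (f : ℝ → ℝ) (k : ℕ) : ℝ :=
  ∫ t in Ioi (0 : ℝ), θ n k t * f t

theorem L_eq_wtSum (c : ℝ) (n : ℕ) (f : ℝ → ℝ) : L c n f = wtSum c (n / c) (szaszCoef n f) := rfl

theorem θ_nonneg (n k : ℕ) {t : ℝ} (ht : 0 ≤ t) : 0 ≤ θ n k t := by
  unfold θ; positivity

theorem continuous_θ (n k : ℕ) : Continuous (θ n k) := by
  unfold θ; fun_prop

/-- Multiplication by `t` shifts the index of the kernel, which yields its moments. -/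
theorem mul_θ {n : ℕ} (hn : 0 < n) (k : ℕ) (t : ℝ) :
    t * θ n k t = ((k : ℝ) + 1) / n * θ n (k + 1) t := by
  unfold θ
  rw [Nat.factorial_succ]
  push_cast
  field_simp
  ring

theorem hasDerivAt_θ_succ (n k : ℕ) (t : ℝ) :
    HasDerivAt (θ n (k + 1)) (n * (θ n k t - θ n (k + 1) t)) t := by
  have hlin : HasDerivAt (fun y : ℝ => (n : ℝ) * y) n t := by
    simpa using (hasDerivAt_id t).const_mul (n : ℝ)
  have h := (((hlin.fun_neg.exp.const_mul (n : ℝ)).mul (hlin.fun_pow (k + 1))).div_const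
    ((k + 1).factorial : ℝ))
  refine h.congr_deriv ?_
  unfold θ
  rw [Nat.factorial_succ]
  push_cast
  have h1 : (k : ℝ) + 1 ≠ 0 := by positivity
  have h2 : (k.factorial : ℝ) ≠ 0 := by positivity
  field_simp
  ring

theorem θ_mul_exp_eq {n : ℕ} (k : ℕ) (l t : ℝ) :
    θ n k t * Real.exp (l * t) =
      (n : ℝ) ^ (k + 1) / k.factorial * (t ^ k * Real.exp (-((n - l) * t))) := by
  unfold θ
  rw [show -(((n : ℝ) - l) * t) = -(n * t) + l * t by ring, Real.exp_add]
  ring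

theorem integrableOn_θ_mul_exp {n : ℕ} (k : ℕ) {l : ℝ} (hl : l < n) :
    IntegrableOn (fun t => θ n k t * Real.exp (l * t)) (Ioi 0) := by
  simp only [θ_mul_exp_eq]
  refine Integrable.const_mul ?_ _
  have h := integrableOn_rpow_mul_exp_neg_mul_rpow (s := k) (p := 1) (b := n - l)
    (by linarith [(Nat.cast_nonneg k : (0 : ℝ) ≤ k)]) one_pos (by linarith)
  simp only [Real.rpow_natCast, Real.rpow_one, neg_mul] at h
  exact h

theorem integral_θ_mul_exp {n : ℕ} (k : ℕ) {l : ℝ} (hl : l < n) :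
    ∫ t in Ioi (0 : ℝ), θ n k t * Real.exp (l * t) = ((n : ℝ) / (n - l)) ^ (k + 1) := by
  have h := Real.integral_rpow_mul_exp_neg_mul_Ioi (a := k + 1) (r := n - l) (by positivity)
    (by linarith)
  simp only [add_sub_cancel_right, Real.rpow_natCast, Real.Gamma_nat_eq_factorial] at h
  simp only [θ_mul_exp_eq]
  rw [integral_const_mul, h]
  have : ((k : ℝ) + 1) = ((k + 1 : ℕ) : ℝ) := by push_cast; rfl
  rw [this, Real.rpow_natCast, div_pow, div_pow, one_pow]
  have : (n : ℝ) - l ≠ 0 := by linarith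
  field_simp

theorem integrableOn_θ {n : ℕ} (hn : 0 < n) (k : ℕ) : IntegrableOn (θ n k) (Ioi 0) := by
  simpa using integrableOn_θ_mul_exp (n := n) (l := 0) k (by exact_mod_cast hn)

theorem integral_θ {n : ℕ} (hn : 0 < n) (k : ℕ) : ∫ t in Ioi (0 : ℝ), θ n k t = 1 := by
  have h : (n : ℝ) ≠ 0 := by positivity
  simpa [h] using integral_θ_mul_exp (n := n) (l := 0) k (by exact_mod_cast hn)

theorem integrableOn_θ_mul_id {n : ℕ} (hn : 0 < n) (k : ℕ) :
    IntegrableOn (fun t => θ n k t * t) (Ioi 0) := by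
  simp only [mul_comm (θ n k _), mul_θ hn]
  exact (integrableOn_θ hn (k + 1)).const_mul _

theorem integral_θ_mul_id {n : ℕ} (hn : 0 < n) (k : ℕ) :
    ∫ t in Ioi (0 : ℝ), θ n k t * t = ((k : ℝ) + 1) / n := by
  simp only [mul_comm (θ n k _), mul_θ hn]
  rw [integral_const_mul, integral_θ hn, mul_one]

theorem θ_mul_sq {n : ℕ} (hn : 0 < n) (k : ℕ) (t : ℝ) :
    θ n k t * t ^ 2 = ((k : ℝ) + 1) * (k + 2) / n ^ 2 * θ n (k + 2) t := by
  have h1 := mul_θ hn k t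
  have h2 := mul_θ hn (k + 1) t
  push_cast at h2
  calc θ n k t * t ^ 2 = t * (t * θ n k t) := by ring
    _ = ((k : ℝ) + 1) / n * (t * θ n (k + 1) t) := by rw [h1]; ring
    _ = _ := by rw [h2]; field_simp; ring

theorem integrableOn_θ_mul_sq {n : ℕ} (hn : 0 < n) (k : ℕ) :
    IntegrableOn (fun t => θ n k t * t ^ 2) (Ioi 0) := by
  simp only [θ_mul_sq hn]
  exact (integrableOn_θ hn (k + 2)).const_mul _

theorem integral_θ_mul_sq {n : ℕ} (hn : 0 < n) (k : ℕ) :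
    ∫ t in Ioi (0 : ℝ), θ n k t * t ^ 2 = ((k : ℝ) + 1) * (k + 2) / n ^ 2 := by
  simp only [θ_mul_sq hn]
  rw [integral_const_mul, integral_θ hn, mul_one]

theorem integrableOn_θ_mul {n : ℕ} (k : ℕ) {f : ℝ → ℝ} {K l : ℝ} (hl : l < n)
    (hf : AEStronglyMeasurable f (volume.restrict (Ioi (0 : ℝ))))
    (hb : ∀ t, 0 < t → |f t| ≤ K * Real.exp (l * t)) :
    IntegrableOn (fun t => θ n k t * f t) (Ioi 0) := by
  refine Integrable.mono' ((integrableOn_θ_mul_exp k hl).const_mul K)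
    ((continuous_θ n k).aestronglyMeasurable.mul hf) ?_
  filter_upwards [ae_restrict_mem measurableSet_Ioi] with t ht
  have h0 := θ_nonneg n k (le_of_lt ht)
  rw [Real.norm_eq_abs, abs_mul, abs_of_nonneg h0]
  calc _ ≤ θ n k t * (K * Real.exp (l * t)) := mul_le_mul_of_nonneg_left (hb t ht) h0
    _ = _ := by ring

theorem abs_szaszCoef_le {n : ℕ} (k : ℕ) {f φ : ℝ → ℝ}
    (hφ : IntegrableOn (fun t => θ n k t * φ t) (Ioi 0)) (hb : ∀ t, 0 < t → |f t| ≤ φ t) :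
    |szaszCoef n f k| ≤ szaszCoef n φ k := by
  refine norm_integral_le_of_norm_le (f := fun t => θ n k t * f t) hφ ?_
  filter_upwards [ae_restrict_mem measurableSet_Ioi] with t ht
  have h0 := θ_nonneg n k (le_of_lt ht)
  rw [Real.norm_eq_abs, abs_mul, abs_of_nonneg h0]
  exact mul_le_mul_of_nonneg_left (hb t ht) h0

theorem abs_szaszCoef_le_of_bounded {n : ℕ} (hn : 0 < n) (k : ℕ) {f : ℝ → ℝ} {M : ℝ}
    (hb : ∀ t, 0 < t → |f t| ≤ M) : |szaszCoef n f k| ≤ M := by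
  have h := abs_szaszCoef_le k (φ := fun _ => M) ((integrableOn_θ hn k).mul_const M) hb
  rwa [szaszCoef.eq_1 n fun _ => M, integral_mul_const, integral_θ hn, one_mul] at h

/-- Integration by parts, in the form `θ_{n,k} - θ_{n,k+1} = θ_{n,k+1}' / n`: a forward
difference of the coefficients of `F` is a coefficient of `F'`. -/
theorem fwdDiff_szaszCoef {n : ℕ} {F F' : ℝ → ℝ} {K l : ℝ} (hn : 0 < n) (hl : l < n)
    (hF : ∀ t, HasDerivAt F (F' t) t) (hF' : Continuous F')
    (hb : ∀ t, 0 < t → |F t| ≤ K * Real.exp (l * t))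
    (hb' : ∀ t, 0 < t → |F' t| ≤ K * Real.exp (l * t)) (k : ℕ) :
    fwdDiff 1 (szaszCoef n F) k = (n : ℝ)⁻¹ * szaszCoef n F' (k + 1) := by
  have hFc : Continuous F := continuous_iff_continuousAt.2 fun t => (hF t).continuousAt
  have hi : ∀ j, IntegrableOn (fun t => θ n j t * F t) (Ioi 0) := fun j =>
    integrableOn_θ_mul j hl hFc.aestronglyMeasurable hb
  have hi' : ∀ j, IntegrableOn (fun t => θ n j t * F' t) (Ioi 0) := fun j =>
    integrableOn_θ_mul j hl hF'.aestronglyMeasurable hb'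
  have hder : ∀ t, HasDerivAt (fun t => θ n (k + 1) t * F t)
      (n * (θ n k t * F t - θ n (k + 1) t * F t) + θ n (k + 1) t * F' t) t := fun t =>
    ((hasDerivAt_θ_succ n k t).mul (hF t)).congr_deriv (by ring)
  have hint : IntegrableOn (fun t => n * (θ n k t * F t - θ n (k + 1) t * F t)
      + θ n (k + 1) t * F' t) (Ioi 0) := (((hi k).sub (hi (k + 1))).const_mul _).add (hi' (k + 1))
  have hlim := tendsto_zero_of_hasDerivAt_of_integrableOn_Ioi (fun t _ => hder t) hint (hi (k + 1))
  have h := integral_Ioi_of_hasDerivAt_of_tendsto' (fun t _ => hder t) hint hlim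
  rw [integral_add (f := fun t => n * (θ n k t * F t - θ n (k + 1) t * F t))
    (((hi k).sub (hi (k + 1))).const_mul _) (hi' (k + 1)), integral_const_mul,
    integral_sub (hi k) (hi (k + 1))] at h
  have h0 : θ n (k + 1) 0 = 0 := by simp [θ]
  rw [h0] at h
  have hn' : (n : ℝ) ≠ 0 := by positivity
  simp only [fwdDiff, szaszCoef]
  field_simp
  linarith

/-- The `r`-th difference of the coefficients of `F` consists of coefficients of `F^{(r)}`, with the
index shifted by `r`. -/
theorem fwdDiff_iterate_szaszCoef {n : ℕ} {F : ℝ → ℝ} {K l : ℝ} (hn : 0 < n) (hl : l < n) (r : ℕ)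
    (hF : ContDiff ℝ r F)
    (hb : ∀ j ≤ r, ∀ t, 0 < t → |iteratedDeriv j F t| ≤ K * Real.exp (l * t)) (k : ℕ) :
    (fwdDiff 1)^[r] (szaszCoef n F) k =
      ((n : ℝ) ^ r)⁻¹ * szaszCoef n (iteratedDeriv r F) (k + r) := by
  induction r generalizing k with
  | zero => simp
  | succ r ih =>
    have ih' := ih (hF.of_le (by exact_mod_cast Nat.le_succ r)) fun j hj => hb j (by omega)
    have hd : ∀ t, HasDerivAt (iteratedDeriv r F) (iteratedDeriv (r + 1) F t) t := fun t => by
      rw [iteratedDeriv_succ]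
      exact (hF.differentiable_iteratedDeriv r (by exact_mod_cast Nat.lt_succ_self r) t).hasDerivAt
    have h := fwdDiff_szaszCoef hn hl hd (hF.continuous_iteratedDeriv (r + 1) le_rfl)
      (hb r (by omega)) (hb (r + 1) le_rfl) (k + r)
    rw [Function.iterate_succ_apply', fwdDiff, ih', ih', ← mul_sub, pow_succ, mul_inv, mul_assoc,
      add_right_comm, ← add_assoc]
    rw [fwdDiff] at h
    rw [h]

/-! ### Second differences and local linearization -/

theorem omega2_nonneg (g : ℝ → ℝ) (δ a b : ℝ) : 0 ≤ omega2 g δ a b := by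
  refine Real.sSup_nonneg ?_
  rintro y ⟨h, x, -, -, -, -, rfl⟩
  exact abs_nonneg _

theorem abs_secondDiff_le_omega2 {g : ℝ → ℝ} {δ a b y s : ℝ} (hg : ContinuousOn g (Icc a b))
    (hs : 0 ≤ s) (hsδ : s ≤ δ) (h1 : a ≤ y - s) (h2 : y + s ≤ b) :
    |g (y + s) - 2 * g y + g (y - s)| ≤ omega2 g δ a b := by
  obtain ⟨K, hK⟩ := isCompact_Icc.exists_bound_of_continuousOn hg
  refine le_csSup ⟨4 * K, ?_⟩ ⟨s, y - s, hs, hsδ, ⟨h1, by linarith⟩, ⟨by linarith, by linarith⟩, ?_⟩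
  · rintro z ⟨h, x, h0, -, hx, hxh, rfl⟩
    have e1 := abs_le.1 (hK x hx)
    have e2 := abs_le.1 (hK (x + h) ⟨by linarith [hx.1], by linarith [hxh.2]⟩)
    have e3 := abs_le.1 (hK _ hxh)
    rw [abs_le]; constructor <;> linarith
  · rw [show y - s + 2 * s = y + s by ring, show y - s + s = y by ring]

/-- A function vanishing at `x`, small at `x + h` and with second differences of step at most `h`
bounded by `ω` is small on `[x, x + h]`: reflect the nearer end point at a maximum point. -/
theorem abs_le_of_secondDiff_le_of_mem_Icc {D : ℝ → ℝ} {x h ω : ℝ} (hh : 0 < h)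
    (hD : ContinuousOn D (Icc x (x + h)))
    (hω : ∀ y s, 0 ≤ s → s ≤ h → x ≤ y - s → y + s ≤ x + h →
      |D (y + s) - 2 * D y + D (y - s)| ≤ ω)
    (h0 : D x = 0) (h1 : |D (x + h)| ≤ ω) {t : ℝ} (ht : t ∈ Icc x (x + h)) : |D t| ≤ 2 * ω := by
  obtain ⟨z, hz, hmax⟩ := isCompact_Icc.exists_isMaxOn (nonempty_Icc.2 (by linarith)) hD.abs
  have hm : ∀ y ∈ Icc x (x + h), |D y| ≤ |D z| := fun y hy => hmax hy
  have hω0 := (abs_nonneg _).trans h1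
  refine (hm t ht).trans ?_
  rcases le_total z (x + h / 2) with hzx | hzx
  · have e := hω z (z - x) (by linarith [hz.1]) (by linarith [hz.2]) (by linarith)
      (by linarith)
    rw [sub_sub_cancel, h0] at e
    have e2 := abs_le.1 (hm (z + (z - x)) ⟨by linarith [hz.1], by linarith⟩)
    have e' := abs_le.1 e
    rcases abs_cases (D z) with h | h <;> linarith [h.1, h.2]
  · have e := hω z (x + h - z) (by linarith [hz.2]) (by linarith [hz.1]) (by linarith)
      (by linarith)
    rw [add_sub_cancel] at e
    have e2 := abs_le.1 (hm (z - (x + h - z)) ⟨by linarith, by linarith [hz.2]⟩)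
    have e3 := abs_le.1 h1
    have e' := abs_le.1 e
    rcases abs_cases (D z) with h | h <;> linarith [h.1, h.2]

/-- Discrete Taylor estimate for a sequence with second differences bounded by `ω`. -/
theorem abs_le_of_secondDiff_seq_le {d : ℕ → ℝ} {ω : ℝ} {j : ℕ} (h0 : d 0 = 0)
    (h1 : 1 ≤ j → |d 1| ≤ 2 * ω) (hω : ∀ i, i + 2 ≤ j → |d (i + 2) - 2 * d (i + 1) + d i| ≤ ω)
    {i : ℕ} (hi : i ≤ j) : |d i| ≤ 2 * i ^ 2 * ω := by
  have hstep : ∀ i, i + 1 ≤ j → |d (i + 1) - d i| ≤ (2 + i) * ω := by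
    intro i
    induction i with
    | zero => intro hj; simpa [h0] using h1 hj
    | succ i ih =>
      intro hj
      have e1 := abs_le.1 (ih (by omega))
      have e2 := abs_le.1 (hω i hj)
      push_cast
      rw [abs_le]; constructor <;> linarith
  induction i with
  | zero => simp [h0]
  | succ i ih =>
    have e1 := abs_le.1 (ih (by omega))
    have e2 := hstep i hi
    have hω0 : 0 ≤ ω := by
      have := (abs_nonneg _).trans e2
      by_contra hneg
      nlinarith [(Nat.cast_nonneg i : (0 : ℝ) ≤ i)]
    have e2' := abs_le.1 e2
    have hi0 : 0 ≤ (i : ℝ) * ω := by positivity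
    push_cast
    rw [abs_le]; constructor <;> nlinarith

/-- One-sided version of the local linearization: a function vanishing at `x` and small at `x + h`,
with second differences of step at most `h` bounded by `ω`, grows at most quadratically. -/
theorem abs_le_of_secondDiff_le {D : ℝ → ℝ} {x h v ω : ℝ} (hh : 0 < h) (hv : x + h ≤ v)
    (hD : ContinuousOn D (Icc x v))
    (hω : ∀ y s, 0 ≤ s → s ≤ h → x ≤ y - s → y + s ≤ v →
      |D (y + s) - 2 * D y + D (y - s)| ≤ ω)
    (h0 : D x = 0) (h1 : |D (x + h)| ≤ ω) {t : ℝ} (ht : t ∈ Icc x v) :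
    |D t| ≤ 4 * ω * (1 + ((t - x) / h) ^ 2) := by
  have hω0 := (abs_nonneg _).trans h1
  rcases eq_or_lt_of_le ht.1 with rfl | hxt
  · rw [h0, abs_zero]; positivity
  set u := (t - x) / h with hu
  have hu0 : 0 < u := div_pos (by linarith) hh
  set j := ⌈u⌉₊ with hj
  have hj0 : 0 < j := Nat.ceil_pos.2 hu0
  have hj1 : (j : ℝ) < u + 1 := Nat.ceil_lt_add_one hu0.le
  have hj0' : (0 : ℝ) < j := by exact_mod_cast hj0
  -- reach `t` from `x` in `j` equal steps of length `τ ≤ h`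
  set τ := (t - x) / j with hτ
  have hτ0 : 0 ≤ τ := div_nonneg (by linarith) hj0'.le
  have hjτ : (j : ℝ) * τ = t - x := by rw [hτ]; field_simp
  have hτh : τ ≤ h := by
    rw [hτ, div_le_iff₀ hj0']
    have := (div_le_iff₀ hh).1 (Nat.le_ceil u)
    linarith
  have hmem : ∀ i : ℕ, i ≤ j → x + i * τ ≤ v := by
    intro i hi
    have : (i : ℝ) * τ ≤ j * τ := by gcongr
    linarith [ht.2]
  have key := abs_le_of_secondDiff_seq_le (d := fun i => D (x + i * τ)) (ω := ω) (j := j)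
    (by simpa using h0)
    (fun _ => by
      simp only [Nat.cast_one, one_mul]
      exact abs_le_of_secondDiff_le_of_mem_Icc hh (hD.mono (Icc_subset_Icc_right hv))
        (fun y s hs hsh hy1 hy2 => hω y s hs hsh hy1 (hy2.trans hv)) h0 h1
        ⟨by linarith, by linarith⟩)
    (fun i hi => by
      have e := hω (x + (i + 1 : ℕ) * τ) τ hτ0 hτh
        (by push_cast; nlinarith [(Nat.cast_nonneg i : (0 : ℝ) ≤ i)])
        (by have := hmem (i + 2) hi; push_cast at this ⊢; linarith)
      have e1 : x + (i + 1 : ℕ) * τ + τ = x + (i + 2 : ℕ) * τ := by push_cast; ring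
      have e2 : x + (i + 1 : ℕ) * τ - τ = x + i * τ := by push_cast; ring
      rwa [e1, e2] at e)
    le_rfl
  have e : x + (j : ℝ) * τ = t := by rw [hjτ]; ring
  simp only [e] at key
  refine key.trans ?_
  have : (j : ℝ) ^ 2 ≤ 2 * (1 + u ^ 2) := by nlinarith [sq_nonneg (u - 1)]
  nlinarith

/-- **Local linearization.** At every interior point `x` there is a line through `(x, g x)`
from which `g` deviates by at most a multiple of `ω₂(g; h)`, with quadratic growth on the
scale `h`. -/
theorem exists_slope_abs_sub_le {g : ℝ → ℝ} {a b x h : ℝ} (hg : ContinuousOn g (Icc a b))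
    (hh : 0 < h) (ha : a ≤ x - h) (hb : x + h ≤ b) :
    ∃ m : ℝ, ∀ t ∈ Icc a b,
      |g t - (g x + m * (t - x))| ≤ 4 * omega2 g h a b * (1 + ((t - x) / h) ^ 2) := by
  set ω := omega2 g h a b
  -- the symmetric slope makes the deviations at `x + h` and `x - h` equal
  set m := (g (x + h) - g (x - h)) / (2 * h) with hm
  have hmh : m * h = (g (x + h) - g (x - h)) / 2 := by rw [hm]; field_simp
  have hsd := abs_le.1 (abs_secondDiff_le_omega2 hg hh.le le_rfl ha hb)
  have hω0 : 0 ≤ ω := omega2_nonneg _ _ _ _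
  refine ⟨m, fun t ht => ?_⟩
  set D : ℝ → ℝ := fun y => g y - (g x + m * (y - x)) with hDdef
  have hDc : ContinuousOn D (Icc a b) := hg.sub (by fun_prop)
  have hDω : ∀ y s, 0 ≤ s → s ≤ h → a ≤ y - s → y + s ≤ b →
      |D (y + s) - 2 * D y + D (y - s)| ≤ ω := by
    intro y s hs hsh h1 h2
    have e := abs_secondDiff_le_omega2 hg hs hsh h1 h2
    convert! e using 2
    simp only [hDdef]; ring
  have hDx : D x = 0 := by simp [hDdef]
  rcases le_total x t with hxt | hxt
  · refine abs_le_of_secondDiff_le hh hb (hDc.mono (Icc_subset_Icc_left (by linarith)))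
      (fun y s hs hsh h1 h2 => hDω y s hs hsh (by linarith) h2) hDx ?_ ⟨hxt, ht.2⟩
    rw [abs_le]
    simp only [hDdef, add_sub_cancel_left, hmh]
    constructor <;> linarith
  · have key := abs_le_of_secondDiff_le (D := fun y => D (2 * x - y)) (x := x) (h := h)
      (v := 2 * x - a) (ω := ω) (t := 2 * x - t) hh (by linarith)
      (hDc.comp (by fun_prop) fun y hy => ⟨by linarith [hy.2], by linarith [hy.1]⟩)
      (fun y s hs hsh h1 h2 => by
        have e := hDω (2 * x - y) s hs hsh (by linarith) (by linarith)
        rw [show 2 * x - (y + s) = 2 * x - y - s by ring,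
          show 2 * x - (y - s) = 2 * x - y + s by ring]
        convert! e using 2
        ring)
      (by rw [show 2 * x - x = x by ring]; exact hDx)
      (by
        rw [show 2 * x - (x + h) = x - h by ring, abs_le]
        simp only [hDdef, sub_sub_cancel_left, mul_neg, hmh]
        constructor <;> linarith)
      ⟨by linarith, by linarith [ht.1]⟩
    rw [sub_sub_cancel, show (2 * x - t - x) / h = -((t - x) / h) by ring, neg_sq] at key
    exact key

/-! ### Recovering an affine derivative from the size of the function -/

theorem hasDerivAt_iteratedDerivWithin_Icc {f : ℝ → ℝ} {a b t : ℝ} {r : ℕ}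
    (hf : ContDiffOn ℝ (r + 1 : ℕ) f (Icc a b)) (ht : t ∈ Ioo a b) :
    HasDerivAt (iteratedDerivWithin r f (Icc a b))
      (iteratedDerivWithin (r + 1) f (Icc a b) t) t := by
  have h := hf.differentiableOn_iteratedDerivWithin (m := r) (by exact_mod_cast Nat.lt_succ_self r)
    (uniqueDiffOn_Icc (ht.1.trans ht.2)) t (Ioo_subset_Icc_self ht)
  rw [iteratedDerivWithin_succ]
  exact h.hasDerivWithinAt.hasDerivAt (Icc_mem_nhds ht.1 ht.2)

/-- A function bounded by `M` on an interval of length `l` has a point there at which its `r`-th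
derivative is at most a multiple of `M`. -/
theorem exists_abs_iteratedDerivWithin_le (r : ℕ) {l : ℝ} (hl : 0 < l) :
    ∃ C : ℝ, 0 ≤ C ∧ ∀ (f : ℝ → ℝ) (a b u v M : ℝ), ContDiffOn ℝ r f (Icc a b) →
      a ≤ u → v ≤ b → v - u = l → (∀ t ∈ Icc u v, |f t| ≤ M) →
      ∃ ξ ∈ Icc u v, |iteratedDerivWithin r f (Icc a b) ξ| ≤ C * M := by
  induction r generalizing l with
  | zero =>
    refine ⟨1, zero_le_one, fun f a b u v M _ _ _ huv hM => ⟨u, ⟨le_rfl, by linarith⟩, ?_⟩⟩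
    simpa using hM u ⟨le_rfl, by linarith⟩
  | succ r ih =>
    obtain ⟨C, hC, h⟩ := ih (l := l / 3) (by linarith)
    refine ⟨2 * C * (3 / l), by positivity, fun f a b u v M hf hau hvb huv hM => ?_⟩
    -- the mean value theorem between points of the first and of the last third
    have hf' : ContDiffOn ℝ r f (Icc a b) := hf.of_le (by exact_mod_cast Nat.le_succ r)
    obtain ⟨ξ₁, h₁, hb₁⟩ := h f a b u (u + l / 3) M hf' hau (by linarith) (by ring)
      fun t ht => hM t ⟨ht.1, by linarith [ht.2]⟩
    obtain ⟨ξ₂, h₂, hb₂⟩ := h f a b (v - l / 3) v M hf' (by linarith) hvb (by ring)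
      fun t ht => hM t ⟨by linarith [ht.1], ht.2⟩
    have hlt : l / 3 ≤ ξ₂ - ξ₁ := by linarith [h₁.2, h₂.1]
    have hpos : 0 < ξ₂ - ξ₁ := by linarith
    obtain ⟨ξ, hξ, he⟩ := exists_hasDerivAt_eq_slope (iteratedDerivWithin r f (Icc a b))
      (iteratedDerivWithin (r + 1) f (Icc a b)) (by linarith : ξ₁ < ξ₂)
      ((hf.continuousOn_iteratedDerivWithin (by exact_mod_cast Nat.le_succ r)
        (uniqueDiffOn_Icc (by linarith))).mono
        (Icc_subset_Icc (by linarith [h₁.1]) (by linarith [h₂.2])))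
      fun t ht => hasDerivAt_iteratedDerivWithin_Icc hf
        ⟨by linarith [ht.1, h₁.1], by linarith [ht.2, h₂.2]⟩
    refine ⟨ξ, ⟨by linarith [hξ.1, h₁.1], by linarith [hξ.2, h₂.2]⟩, ?_⟩
    have hM0 : 0 ≤ C * M := (abs_nonneg _).trans hb₁
    rw [he, abs_div, abs_of_pos hpos, div_le_iff₀ hpos]
    calc _ ≤ 2 * (C * M) := by
          have := abs_sub (iteratedDerivWithin r f (Icc a b) ξ₂)
            (iteratedDerivWithin r f (Icc a b) ξ₁)
          linarith
      _ = 2 * C * (3 / l) * M * (l / 3) := by field_simp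
      _ ≤ _ := by
          refine mul_le_mul_of_nonneg_left hlt ?_
          rw [show 2 * C * (3 / l) * M = 2 * (3 / l) * (C * M) by ring]
          positivity

/-- If the `r`-th derivative of `f` is within `W` of an affine function on `[a, b]`, the
coefficients of that function are controlled by `W` and the size of `f` itself. -/
theorem exists_abs_affine_coeff_le (r : ℕ) {a b : ℝ} (hab : a < b) :
    ∃ C : ℝ, 0 ≤ C ∧ ∀ (f : ℝ → ℝ) (M W x y m : ℝ), ContDiffOn ℝ r f (Icc a b) →
      (∀ t ∈ Icc a b, |f t| ≤ M) → x ∈ Icc a b →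
      (∀ t ∈ Icc a b, |iteratedDerivWithin r f (Icc a b) t - (y + m * (t - x))| ≤ W) →
      |y| ≤ C * (M + W) ∧ |m| ≤ C * (M + W) := by
  set l := b - a with hldef
  have hl : 0 < l := by linarith
  obtain ⟨C, hC, h⟩ := exists_abs_iteratedDerivWithin_le r (l := l / 3) (by linarith)
  refine ⟨7 * (C + 1) + 6 / l * (C + 1), by positivity, fun f M W x y m hf hM hx hW => ?_⟩
  obtain ⟨ξ₁, h₁, hb₁⟩ := h f a b a (a + l / 3) M hf le_rfl (by linarith) (by ring)
    fun t ht => hM t ⟨ht.1, by linarith [ht.2]⟩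
  obtain ⟨ξ₂, h₂, hb₂⟩ := h f a b (b - l / 3) b M hf (by linarith) le_rfl (by ring)
    fun t ht => hM t ⟨by linarith [ht.1], ht.2⟩
  have hM0 : 0 ≤ M := (abs_nonneg _).trans (hM x hx)
  have hW0 : 0 ≤ W := (abs_nonneg _).trans (hW x hx)
  have hlt : l / 3 ≤ ξ₂ - ξ₁ := by linarith [h₁.2, h₂.1]
  have w₁ := abs_le.1 (hW ξ₁ ⟨h₁.1, by linarith [h₁.2]⟩)
  have w₂ := abs_le.1 (hW ξ₂ ⟨by linarith [h₂.1], h₂.2⟩)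
  have v₁ := abs_le.1 hb₁
  have v₂ := abs_le.1 hb₂
  have hm : |m| * (l / 3) ≤ 2 * (C * M + W) := by
    calc |m| * (l / 3) ≤ |m| * (ξ₂ - ξ₁) := by gcongr
      _ = |m * (ξ₂ - ξ₁)| := by rw [abs_mul, abs_of_nonneg (by linarith : 0 ≤ ξ₂ - ξ₁)]
      _ ≤ _ := by rw [abs_le]; constructor <;> linarith
  have hCM : C * M + W ≤ (C + 1) * (M + W) := by nlinarith
  have hm' : |m| ≤ 6 / l * (C + 1) * (M + W) := by
    rw [mul_assoc, div_mul_eq_mul_div, le_div_iff₀ hl]; linarith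
  have hsum : 0 ≤ (C + 1) * (M + W) := by positivity
  have hsum' : 0 ≤ 6 / l * (C + 1) * (M + W) := by positivity
  refine ⟨?_, by linarith⟩
  have hmx : |m * (ξ₁ - x)| ≤ |m| * l := by
    rw [abs_mul]
    refine mul_le_mul_of_nonneg_left ?_ (abs_nonneg m)
    rw [abs_le]; constructor <;> linarith [h₁.1, h₁.2, hx.1, hx.2]
  have hmx' := abs_le.1 hmx
  have : |y| ≤ C * M + W + |m| * l := by rw [abs_le]; constructor <;> linarith
  nlinarith

/-! ### Smooth extension from a compact interval -/

/-- A function that is `C^r` on `[a, b]` extends to a `C^r` function on the line whose `r`-th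
derivative is constant on either side of `[a, b]`. -/
theorem exists_contDiff_extension (r : ℕ) {f : ℝ → ℝ} {a b : ℝ} (hab : a < b)
    (hf : ContDiffOn ℝ r f (Icc a b)) :
    ∃ F : ℝ → ℝ, ContDiff ℝ r F ∧ EqOn F f (Icc a b) ∧
      ∀ t, iteratedDeriv r F t = iteratedDerivWithin r f (Icc a b) (projIcc a b hab.le t) := by
  induction r generalizing f with
  | zero =>
    refine ⟨IccExtend hab.le ((Icc a b).domRestrict f), ?_, fun t ht => ?_, fun t => ?_⟩
    · rw [Nat.cast_zero, contDiff_zero]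
      exact (continuousOn_iff_continuous_domRestrict.1 hf.continuousOn).Icc_extend'
    · simp [IccExtend_of_mem hab.le _ ht, domRestrict_apply]
    · simp [IccExtend, domRestrict_apply]
  | succ r ih =>
    have hu := uniqueDiffOn_Icc hab
    rw [Nat.cast_succ, contDiffOn_succ_iff_derivWithin hu] at hf
    obtain ⟨hfd, -, hf'⟩ := hf
    obtain ⟨G, hG, hGf, hGr⟩ := ih hf'
    have hGc := hG.continuous
    have hder : ∀ t, HasDerivAt (fun t => f a + ∫ s in a..t, G s) (G t) t := fun t =>
      (intervalIntegral.integral_hasDerivAt_right (hGc.intervalIntegrable _ _)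
        (hGc.stronglyMeasurableAtFilter _ _) hGc.continuousAt).const_add _
    have hderiv : deriv (fun t => f a + ∫ s in a..t, G s) = G := funext fun t => (hder t).deriv
    refine ⟨fun t => f a + ∫ s in a..t, G s, ?_, fun t ht => ?_, fun t => ?_⟩
    · rw [Nat.cast_succ, contDiff_succ_iff_deriv]
      exact ⟨fun t => (hder t).differentiableAt, by simp, by rw [hderiv]; exact hG⟩
    · have h := intervalIntegral.integral_eq_sub_of_hasDerivAt_of_le ht.1
        (hfd.continuousOn.mono (Icc_subset_Icc_right ht.2)) (f' := G) (fun s hs => by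
          have hs' : s ∈ Icc a b := ⟨hs.1.le, hs.2.le.trans ht.2⟩
          rw [hGf hs']
          exact (hfd s hs').hasDerivWithinAt.hasDerivAt
            (Icc_mem_nhds hs.1 (hs.2.trans_le ht.2))) (hGc.intervalIntegrable _ _)
      simp only [h, add_sub_cancel]
    · rw [iteratedDeriv_succ', hderiv, hGr, iteratedDerivWithin_succ']

/-- Exponential growth of the top derivative, together with a bound for the function on an
interval, gives exponential growth of all lower derivatives. -/
theorem exists_abs_iteratedDeriv_le_mul_exp (r : ℕ) {a b : ℝ} (ha : 0 ≤ a) (hab : a < b) :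
    ∃ C : ℝ, 1 ≤ C ∧ ∀ (F : ℝ → ℝ) (M B : ℝ), ContDiff ℝ r F → (∀ t ∈ Icc a b, |F t| ≤ M) →
      (∀ t, 0 ≤ t → |iteratedDeriv r F t| ≤ B * Real.exp t) →
      ∀ j ≤ r, ∀ t, 0 ≤ t → |iteratedDeriv j F t| ≤ C * (M + B) * Real.exp t := by
  induction r with
  | zero =>
    refine ⟨1, le_rfl, fun F M B _ hM hB j hj t ht => (hB t ht).trans' (by simp [Nat.le_zero.1 hj])
      |>.trans ?_⟩
    have := (abs_nonneg _).trans (hM a ⟨le_rfl, hab.le⟩)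
    gcongr; linarith
  | succ r ih =>
    obtain ⟨C₀, hC₀, h₀⟩ := exists_abs_iteratedDerivWithin_le r (sub_pos.2 hab)
    obtain ⟨C₁, hC₁, h₁⟩ := ih
    refine ⟨C₁ * (2 + C₀ + Real.exp b), ?_, fun F M B hF hM hB => ?_⟩
    · nlinarith [Real.exp_pos b]
    have hM0 : 0 ≤ M := (abs_nonneg _).trans (hM a ⟨le_rfl, hab.le⟩)
    have hB0 : 0 ≤ B := by
      have := (abs_nonneg _).trans (hB 0 le_rfl)
      simpa using this
    have hF' : ContDiff ℝ r F := hF.of_le (by exact_mod_cast Nat.le_succ r)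
    obtain ⟨ξ, hξ, hbξ⟩ := h₀ F a b a b M hF'.contDiffOn le_rfl le_rfl rfl hM
    rw [iteratedDerivWithin_eq_iteratedDeriv (uniqueDiffOn_Icc hab) hF'.contDiffAt hξ] at hbξ
    have hcont := hF.continuous_iteratedDeriv (r + 1) le_rfl
    have hd : ∀ t, HasDerivAt (iteratedDeriv r F) (iteratedDeriv (r + 1) F t) t := fun t => by
      rw [iteratedDeriv_succ]
      exact (hF.differentiable_iteratedDeriv r (by exact_mod_cast Nat.lt_succ_self r) t).hasDerivAt
    have hξ0 : 0 ≤ ξ := ha.trans hξ.1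
    have hr : ∀ t, 0 ≤ t →
        |iteratedDeriv r F t| ≤ (C₀ * M + B * (1 + Real.exp b)) * Real.exp t := by
      intro t ht
      have hint := intervalIntegral.integral_eq_sub_of_hasDerivAt (a := ξ) (b := t)
        (fun s _ => hd s) (hcont.intervalIntegrable _ _)
      have hexp : ∫ s in ξ..t, B * Real.exp s = B * (Real.exp t - Real.exp ξ) := by
        rw [intervalIntegral.integral_const_mul, integral_exp]
      have hle := intervalIntegral.norm_integral_le_abs_of_norm_le (μ := volume) (a := ξ) (b := t)
        (f := iteratedDeriv (r + 1) F) (g := fun s => B * Real.exp s)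
        ((ae_restrict_mem measurableSet_uIoc).mono fun s hs =>
          hB s ((le_min hξ0 ht).trans hs.1.le))
        ((by fun_prop : Continuous fun s => B * Real.exp s).intervalIntegrable _ _)
      rw [hint, hexp, Real.norm_eq_abs, abs_mul, abs_of_nonneg hB0] at hle
      have h1t : 1 ≤ Real.exp t := Real.one_le_exp ht
      have hξb : Real.exp ξ ≤ Real.exp b := Real.exp_le_exp.2 hξ.2
      have hsub : |Real.exp t - Real.exp ξ| ≤ (1 + Real.exp b) * Real.exp t := by
        rw [abs_le]; constructor <;> nlinarith [Real.exp_pos ξ, Real.exp_pos b]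
      have hCM : 0 ≤ C₀ * M := by positivity
      calc |iteratedDeriv r F t|
          ≤ |iteratedDeriv r F ξ| + |iteratedDeriv r F t - iteratedDeriv r F ξ| := by
            have := abs_add_le (iteratedDeriv r F ξ) (iteratedDeriv r F t - iteratedDeriv r F ξ)
            simpa using this
        _ ≤ C₀ * M * Real.exp t + B * ((1 + Real.exp b) * Real.exp t) := by
            refine add_le_add (hbξ.trans (le_mul_of_one_le_right hCM h1t)) (hle.trans ?_)
            gcongr
        _ = _ := by ring
    have hlow := h₁ F M _ hF' hM hr
    intro j hj t ht
    have he := Real.exp_pos t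
    rcases Nat.lt_or_ge j (r + 1) with hj' | hj'
    · refine (hlow j (by omega) t ht).trans ?_
      refine mul_le_mul_of_nonneg_right ?_ he.le
      rw [mul_assoc]
      refine mul_le_mul_of_nonneg_left ?_ (by linarith)
      nlinarith [Real.exp_pos b, mul_nonneg hC₀ hB0, mul_nonneg (Real.exp_pos b).le hM0]
    · obtain rfl : j = r + 1 := by omega
      refine (hB t ht).trans (mul_le_mul_of_nonneg_right ?_ he.le)
      have : 1 ≤ C₁ * (2 + C₀ + Real.exp b) := by nlinarith [Real.exp_pos b]
      nlinarith

/-! ### Exponentially small tails -/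

theorem summable_and_abs_wtSum_le {c S x : ℝ} {A φ : ℕ → ℝ} {s : ℝ} (hc : 0 < c) (hS : 0 ≤ S)
    (hx : 0 ≤ x) (hA : ∀ k, |A k| ≤ φ k) (hφ : HasSum (fun k => wt c S k x * φ k) s) :
    (Summable fun k => wt c S k x * A k) ∧ |wtSum c S A x| ≤ s := by
  have hle : ∀ k, ‖wt c S k x * A k‖ ≤ wt c S k x * φ k := fun k => by
    rw [norm_mul, Real.norm_eq_abs, Real.norm_eq_abs, abs_of_nonneg (wt_nonneg hc hS hx k)]
    exact mul_le_mul_of_nonneg_left (hA k) (wt_nonneg hc hS hx k)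
  exact ⟨Summable.of_norm_bounded hφ.summable hle, tsum_of_norm_bounded hφ hle⟩

theorem abs_fwdDiff_iterate_le_of_geometric {A : ℕ → ℝ} {P Q w v : ℝ} (hP : 0 ≤ P) (hQ : 0 ≤ Q)
    (hw : 0 ≤ w) (hw2 : w ≤ 2) (hv : 0 ≤ v) (hv2 : v ≤ 2)
    (hA : ∀ k, |A k| ≤ P * w ^ k + Q * v ^ k) (r k : ℕ) :
    |(fwdDiff 1)^[r] A k| ≤ 3 ^ r * (P * w ^ k + Q * v ^ k) := by
  induction r generalizing k with
  | zero => simpa using hA k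
  | succ r ih =>
    rw [Function.iterate_succ_apply', fwdDiff]
    have e1 := ih (k + 1)
    have e2 := ih k
    have e3 := abs_sub ((fwdDiff 1)^[r] A (k + 1)) ((fwdDiff 1)^[r] A k)
    have e4 : P * w ^ (k + 1) + Q * v ^ (k + 1) ≤ 2 * (P * w ^ k + Q * v ^ k) := by
      have h1 : P * w ^ k * w ≤ P * w ^ k * 2 := by gcongr
      have h2 : Q * v ^ k * v ≤ Q * v ^ k * 2 := by gcongr
      rw [pow_succ, pow_succ]; linarith
    have e5 : (3 : ℝ) ^ r * (P * w ^ (k + 1) + Q * v ^ (k + 1)) ≤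
        3 ^ r * (2 * (P * w ^ k + Q * v ^ k)) := by gcongr
    rw [pow_succ]
    linarith

/-- The exponential moment of the weights, estimated by `1 - u⁻¹ ≤ log u`. -/
theorem rpow_neg_le_exp {c x S e : ℝ} (hS : 0 ≤ S)
    (he : e * (1 + c * x) < 1) (he1 : e < 1) :
    0 < c * x + 1 - c * x * (1 / (1 - e)) ∧
    (c * x + 1 - c * x * (1 / (1 - e))) ^ (-S) ≤
      Real.exp (S * (c * x * e / (1 - e * (1 + c * x)))) := by
  have h1 : 0 < 1 - e := by linarith
  have h2 : 0 < 1 - e * (1 + c * x) := by linarith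
  have hu : c * x + 1 - c * x * (1 / (1 - e)) = (1 - e * (1 + c * x)) / (1 - e) := by
    field_simp; ring
  have hu0 : 0 < (1 - e * (1 + c * x)) / (1 - e) := by positivity
  rw [hu]
  refine ⟨hu0, ?_⟩
  rw [Real.rpow_def_of_pos hu0]
  refine Real.exp_le_exp.2 ?_
  have h := Real.one_sub_inv_le_log_of_pos hu0
  have hi : 1 - ((1 - e * (1 + c * x)) / (1 - e))⁻¹ =
      -(c * x * e / (1 - e * (1 + c * x))) := by
    rw [inv_div]; field_simp; ring
  rw [hi] at h
  nlinarith

/-- The coefficients of a function supported off `[a, b]`: on `t > b` and on `t < a`, `exp t` is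
majorized by exponentials with tilt `ε n` and `-ε n`, whose coefficients are geometric in `k`. -/
theorem abs_szaszCoef_le_of_eqOn_zero {n : ℕ} {h : ℝ → ℝ} {a b K ε : ℝ} (hn : 0 < n)
    (hε : 0 < ε) (hε1 : ε < 1) (hl : 1 ≤ ε * n) (h0 : ∀ t ∈ Icc a b, h t = 0)
    (hK : ∀ t, 0 < t → |h t| ≤ K * Real.exp t) (k : ℕ) :
    |szaszCoef n h k| ≤
      K * Real.exp (b - ε * n * b) * (1 / (1 - ε)) ^ (k + 1) +
      K * Real.exp (a + ε * n * a) * (1 / (1 - -ε)) ^ (k + 1) := by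
  have hK0 : 0 ≤ K := by
    have := (abs_nonneg _).trans (hK 1 one_pos)
    exact nonneg_of_mul_nonneg_left this (Real.exp_pos 1)
  have hn' : (0 : ℝ) < n := by exact_mod_cast hn
  have hl1 : ε * n < n := by nlinarith
  have hl2 : -(ε * n) < n := by nlinarith
  have i1 := (integrableOn_θ_mul_exp k hl1).const_mul (K * Real.exp (b - ε * n * b))
  have i2 := (integrableOn_θ_mul_exp k hl2).const_mul (K * Real.exp (a + ε * n * a))
  have hsum : ∀ t, θ n k t * (K * Real.exp (b - ε * n * b) * Real.exp (ε * n * t) +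
        K * Real.exp (a + ε * n * a) * Real.exp (-(ε * n) * t)) =
      K * Real.exp (b - ε * n * b) * (θ n k t * Real.exp (ε * n * t)) +
        K * Real.exp (a + ε * n * a) * (θ n k t * Real.exp (-(ε * n) * t)) := fun t => by ring
  have key := abs_szaszCoef_le (f := h) k
    (φ := fun t => K * Real.exp (b - ε * n * b) * Real.exp (ε * n * t) +
        K * Real.exp (a + ε * n * a) * Real.exp (-(ε * n) * t))
    ((i1.add i2).congr (Filter.Eventually.of_forall fun t => (hsum t).symm)) (fun t ht => by
      rw [mul_assoc K, mul_assoc K, ← Real.exp_add, ← Real.exp_add, ← mul_add]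
      have p1 := Real.exp_pos (b - ε * n * b + ε * n * t)
      have p2 := Real.exp_pos (a + ε * n * a + -(ε * n) * t)
      by_cases hab : t ∈ Icc a b
      · rw [h0 t hab, abs_zero]; positivity
      refine (hK t ht).trans (mul_le_mul_of_nonneg_left ?_ hK0)
      rcases lt_or_ge t a with hta | hta
      · have : Real.exp t ≤ Real.exp (a + ε * n * a + -(ε * n) * t) :=
          Real.exp_le_exp.2 (by nlinarith)
        linarith
      · have htb : b < t := by
          by_contra hcon
          exact hab ⟨hta, not_lt.1 hcon⟩
        have : Real.exp t ≤ Real.exp (b - ε * n * b + ε * n * t) :=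
          Real.exp_le_exp.2 (by nlinarith)
        linarith)
  refine key.trans (le_of_eq ?_)
  simp only [szaszCoef, hsum]
  rw [integral_add i1 i2, integral_const_mul, integral_const_mul, integral_θ_mul_exp k hl1,
    integral_θ_mul_exp k hl2]
  congr 3
  · field_simp
  · rw [sub_neg_eq_add, sub_neg_eq_add]; field_simp

/-- **Localization.** The part of a function of exponential growth that lives off `[a, b]`
contributes an exponentially small amount on `[a₁, b₁]`, by a Chernoff bound. -/
theorem exists_abs_wtSum_fwdDiff_le_exp_neg {c : ℝ} (hc : 0 < c) (r : ℕ) {a a₁ b₁ b : ℝ}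
    (ha : 0 ≤ a) (haa₁ : a < a₁) (hab₁ : a₁ ≤ b₁) (hbb₁ : b₁ < b) :
    ∃ C : ℝ, 0 ≤ C ∧ ∃ κ : ℝ, 0 < κ ∧ ∃ N : ℕ, 0 < N ∧ ∀ n : ℕ, N ≤ n → ∀ (h : ℝ → ℝ) (K : ℝ),
      (∀ t ∈ Icc a b, h t = 0) → (∀ t, 0 < t → |h t| ≤ K * Real.exp t) → ∀ x ∈ Icc a₁ b₁,
      (Summable fun k => wt c (n / c + r) k x * (fwdDiff 1)^[r] (szaszCoef n h) k) ∧
      |wtSum c (n / c + r) ((fwdDiff 1)^[r] (szaszCoef n h)) x| ≤ C * K * Real.exp (-(κ * n)) := by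
  set q := 1 + c * b₁ with hq
  have hb₁ : 0 < b₁ := by linarith
  have ha₁ : 0 < a₁ := by linarith
  have hb : 0 < b := by linarith
  have hq0 : 0 < q := by positivity
  have hq1 : 1 ≤ q := by rw [hq]; nlinarith [mul_pos hc hb₁]
  -- the tilt `ε` is so small that the tilted means of `t` stay between `(a + a₁) / 2` and
  -- `(b₁ + b) / 2`
  obtain ⟨ε, hε, hε1, hε2, hε3⟩ : ∃ ε : ℝ, 0 < ε ∧ ε * (2 * q) ≤ 1 ∧
      ε * (q * (b₁ + b)) ≤ b - b₁ ∧ ε * (q * (a₁ + a)) ≤ a₁ - a := by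
    refine ⟨min (1 / (2 * q)) (min ((b - b₁) / (q * (b₁ + b))) ((a₁ - a) / (q * (a₁ + a)))),
      lt_min (by positivity) (lt_min ?_ ?_), ?_, ?_, ?_⟩
    · exact div_pos (by linarith) (by positivity)
    · exact div_pos (by linarith) (by positivity)
    · exact (le_div_iff₀ (by positivity)).1 (min_le_left _ _)
    · exact (le_div_iff₀ (by positivity)).1 ((min_le_right _ _).trans (min_le_left _ _))
    · exact (le_div_iff₀ (by positivity)).1 ((min_le_right _ _).trans (min_le_right _ _))
  have hεh : ε ≤ 1 / 2 := by nlinarith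
  obtain ⟨N, hN⟩ := exists_nat_ge (1 / ε)
  refine ⟨2 * 3 ^ r * ((Real.exp b + Real.exp a) * Real.exp (r * c * (b₁ + b))), by positivity,
    ε * (min (b - b₁) (a₁ - a) / 2), ?_, max N 1, by simp, fun n hn h K h0 hK x hx => ?_⟩
  · have : 0 < min (b - b₁) (a₁ - a) := lt_min (by linarith) (by linarith)
    positivity
  have hn0 : 0 < n := lt_of_lt_of_le (by simp) hn
  have hn' : (0 : ℝ) < n := by exact_mod_cast hn0
  have hnN : (N : ℝ) ≤ n := by exact_mod_cast (le_max_left _ _).trans hn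
  have hl : 1 ≤ ε * n := by
    have := (div_le_iff₀ hε).1 (hN.trans hnN)
    linarith
  have hK0 : 0 ≤ K :=
    nonneg_of_mul_nonneg_left ((abs_nonneg _).trans (hK 1 one_pos)) (Real.exp_pos 1)
  have hx0 : 0 < x := by linarith [hx.1]
  have hxq : 1 + c * x ≤ q := by rw [hq]; nlinarith [hx.2]
  have hxq0 : 0 < 1 + c * x := by positivity
  have hεq : ε * (1 + c * x) ≤ ε * q := by gcongr
  set S := (n : ℝ) / c + r with hS
  have hS0 : 0 ≤ S := by positivity
  have hSc : S * c = n + r * c := by rw [hS]; field_simp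
  set w := 1 / (1 - ε)
  set v := 1 / (1 - -ε)
  have hw0 : 0 ≤ w := one_div_nonneg.2 (by linarith)
  have hw2 : w ≤ 2 := by rw [div_le_iff₀ (by linarith)]; linarith
  have hv0 : 0 ≤ v := one_div_nonneg.2 (by linarith)
  have hv2 : v ≤ 2 := by rw [div_le_iff₀ (by linarith)]; linarith
  set P := K * Real.exp (b - ε * n * b)
  set Q := K * Real.exp (a + ε * n * a)
  have hP : 0 ≤ P := by positivity
  have hQ : 0 ≤ Q := by positivity
  have hA : ∀ k, |szaszCoef n h k| ≤ 2 * P * w ^ k + 2 * Q * v ^ k := fun k => by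
    refine (abs_szaszCoef_le_of_eqOn_zero hn0 hε (by linarith) hl h0 hK k).trans ?_
    have h1 : P * w ^ k * w ≤ P * w ^ k * 2 := by gcongr
    have h2 : Q * v ^ k * v ≤ Q * v ^ k * 2 := by gcongr
    rw [pow_succ, pow_succ]; linarith
  have hΔ := abs_fwdDiff_iterate_le_of_geometric (by positivity) (by positivity) hw0 hw2 hv0 hv2
    hA r
  obtain ⟨u1, E1⟩ := rpow_neg_le_exp (e := ε) (c := c) (x := x) hS0 (by linarith) (by linarith)
  obtain ⟨u2, E2⟩ := rpow_neg_le_exp (e := -ε) (c := c) (x := x) hS0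
    (by have : 0 < ε * (1 + c * x) := by positivity
        linarith) (by linarith)
  have hs := (((hasSum_wt_mul_pow (S := S) hc hx0.le hw0 u1).mul_left (2 * P)).add
    ((hasSum_wt_mul_pow (S := S) hc hx0.le hv0 u2).mul_left (2 * Q))).mul_left (3 ^ r)
  obtain ⟨hsum, hbound⟩ := summable_and_abs_wtSum_le hc hS0 hx0.le hΔ (hs.congr_fun fun k => by
    ring)
  refine ⟨hsum, hbound.trans ?_⟩
  set κ := ε * (min (b - b₁) (a₁ - a) / 2)
  have hκ1 : κ ≤ ε * ((b - b₁) / 2) :=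
    mul_le_mul_of_nonneg_left (by linarith [min_le_left (b - b₁) (a₁ - a)]) hε.le
  have hκ2 : κ ≤ ε * ((a₁ - a) / 2) :=
    mul_le_mul_of_nonneg_left (by linarith [min_le_right (b - b₁) (a₁ - a)]) hε.le
  have hmean1 : x / (1 - ε * (1 + c * x)) ≤ (b₁ + b) / 2 := by
    rw [div_le_iff₀ (by linarith)]
    have := mul_le_mul_of_nonneg_right hεq (by linarith : 0 ≤ b₁ + b)
    linarith [hx.2]
  have hmean2 : (a₁ + a) / 2 ≤ x / (1 - -ε * (1 + c * x)) := by
    have hεx : 0 < ε * (1 + c * x) := by positivity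
    rw [le_div_iff₀ (by linarith)]
    have := mul_le_mul_of_nonneg_right hεq (by linarith : 0 ≤ a₁ + a)
    linarith [hx.1]
  have F1 : P * (c * x + 1 - c * x * w) ^ (-S) ≤
      K * (Real.exp b * Real.exp (r * c * (b₁ + b)) * Real.exp (-(κ * n))) := by
    rw [mul_assoc]
    refine mul_le_mul_of_nonneg_left ?_ hK0
    refine (mul_le_mul_of_nonneg_left E1 (Real.exp_pos _).le).trans ?_
    rw [← Real.exp_add, ← Real.exp_add, ← Real.exp_add]
    refine Real.exp_le_exp.2 ?_
    have e : S * (c * x * ε / (1 - ε * (1 + c * x))) =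
        (n + r * c) * ε * (x / (1 - ε * (1 + c * x))) := by rw [← hSc]; ring
    rw [e]
    have e1 : (n + r * c) * ε * (x / (1 - ε * (1 + c * x))) ≤
        (n + r * c) * ε * ((b₁ + b) / 2) := by gcongr
    have e2 : r * c * ε * ((b₁ + b) / 2) ≤ r * c * 1 * (b₁ + b) := by
      gcongr <;> linarith
    have e3 : κ * n ≤ ε * ((b - b₁) / 2) * n := by gcongr
    linarith
  have F2 : Q * (c * x + 1 - c * x * v) ^ (-S) ≤
      K * (Real.exp a * Real.exp (r * c * (b₁ + b)) * Real.exp (-(κ * n))) := by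
    rw [mul_assoc]
    refine mul_le_mul_of_nonneg_left ?_ hK0
    refine (mul_le_mul_of_nonneg_left E2 (Real.exp_pos _).le).trans ?_
    rw [← Real.exp_add, ← Real.exp_add, ← Real.exp_add]
    refine Real.exp_le_exp.2 ?_
    have e : S * (c * x * -ε / (1 - -ε * (1 + c * x))) =
        -((n + r * c) * ε * (x / (1 - -ε * (1 + c * x)))) := by rw [← hSc]; ring
    rw [e]
    have e1 : (n + r * c) * ε * ((a₁ + a) / 2) ≤
        (n + r * c) * ε * (x / (1 - -ε * (1 + c * x))) := by gcongr
    have e2 : 0 ≤ r * c * ε * ((a₁ + a) / 2) := by positivity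
    have e2' : 0 ≤ r * c * (b₁ + b) := by positivity
    have e3 : κ * n ≤ ε * ((a₁ - a) / 2) * n := by gcongr
    linarith
  have h3 : (0 : ℝ) < 3 ^ r := by positivity
  calc _ = 2 * 3 ^ r * (P * (c * x + 1 - c * x * w) ^ (-S) +
        Q * (c * x + 1 - c * x * v) ^ (-S)) := by ring
    _ ≤ 2 * 3 ^ r * (K * (Real.exp b * Real.exp (r * c * (b₁ + b)) * Real.exp (-(κ * n))) +
        K * (Real.exp a * Real.exp (r * c * (b₁ + b)) * Real.exp (-(κ * n)))) := by gcongr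
    _ = _ := by ring

/-! ### Moments of the operator -/

/-- The normalization `∏_{i<r} (1 + i c / n)` of the `r`-th derivative is `1 + O(1 / n)`. -/
theorem exists_abs_rising_sub_one_le {c : ℝ} (hc : 0 < c) (r : ℕ) :
    ∃ C : ℝ, 0 ≤ C ∧ ∀ n : ℕ, 0 < n →
      |c ^ r * rising (n / c) r * ((n : ℝ) ^ r)⁻¹ - 1| ≤ C * (n : ℝ)⁻¹ := by
  induction r with
  | zero => exact ⟨0, le_rfl, fun n _ => by simp [rising_zero]⟩
  | succ r ih =>
    obtain ⟨C, hC, h⟩ := ih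
    refine ⟨C * (1 + r * c) + r * c, by positivity, fun n hn => ?_⟩
    have hn' : (0 : ℝ) < n := by exact_mod_cast hn
    have hn1 : (n : ℝ)⁻¹ ≤ 1 := inv_le_one_of_one_le₀ (by exact_mod_cast hn)
    have hi : (0 : ℝ) < (n : ℝ)⁻¹ := by positivity
    have h0 := h n hn
    set u := c ^ r * rising (n / c) r * ((n : ℝ) ^ r)⁻¹
    have hstep : c ^ (r + 1) * rising (n / c) (r + 1) * ((n : ℝ) ^ (r + 1))⁻¹ =
        u * (1 + r * c * (n : ℝ)⁻¹) := by
      rw [rising_succ_right]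
      simp only [u]
      field_simp
      ring
    rw [hstep, show u * (1 + r * c * (n : ℝ)⁻¹) - 1 =
      (u - 1) * (1 + r * c * (n : ℝ)⁻¹) + r * c * (n : ℝ)⁻¹ by ring]
    refine (abs_add_le _ _).trans ?_
    rw [abs_mul, abs_of_nonneg (by positivity : 0 ≤ 1 + r * c * (n : ℝ)⁻¹),
      abs_of_nonneg (by positivity : 0 ≤ r * c * (n : ℝ)⁻¹)]
    have : 1 + r * c * (n : ℝ)⁻¹ ≤ 1 + r * c := by
      have := mul_le_mul_of_nonneg_left hn1 (by positivity : 0 ≤ r * c)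
      linarith
    calc _ ≤ C * (n : ℝ)⁻¹ * (1 + r * c) + r * c * (n : ℝ)⁻¹ := by gcongr
      _ = _ := by ring

theorem integrableOn_θ_mul_sub {n : ℕ} (hn : 0 < n) (x : ℝ) (k : ℕ) :
    IntegrableOn (fun t => θ n k t * (t - x)) (Ioi 0) := by
  simp only [mul_sub]
  exact (integrableOn_θ_mul_id hn k).sub ((integrableOn_θ hn k).mul_const x)

theorem szaszCoef_sub {n : ℕ} (hn : 0 < n) (x : ℝ) (k : ℕ) :
    szaszCoef n (fun t => t - x) k = ((k : ℝ) + 1) / n - x := by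
  simp only [szaszCoef, mul_sub]
  rw [integral_sub (integrableOn_θ_mul_id hn k) ((integrableOn_θ hn k).mul_const x),
    integral_mul_const, integral_θ hn, integral_θ_mul_id hn, one_mul]

theorem θ_mul_sub_sq (n k : ℕ) (x t : ℝ) :
    θ n k t * (t - x) ^ 2 = (θ n k t * t ^ 2 - 2 * x * (θ n k t * t)) + θ n k t * x ^ 2 := by
  ring

theorem integrableOn_θ_mul_sub_sq {n : ℕ} (hn : 0 < n) (x : ℝ) (k : ℕ) :
    IntegrableOn (fun t => θ n k t * (t - x) ^ 2) (Ioi 0) := by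
  simp only [θ_mul_sub_sq]
  exact ((integrableOn_θ_mul_sq hn k).sub ((integrableOn_θ_mul_id hn k).const_mul _)).add
    ((integrableOn_θ hn k).mul_const _)

theorem szaszCoef_sub_sq {n : ℕ} (hn : 0 < n) (x : ℝ) (k : ℕ) :
    szaszCoef n (fun t => (t - x) ^ 2) k =
      ((k : ℝ) + 1) * (k + 2) / n ^ 2 - 2 * x * (((k : ℝ) + 1) / n) + x ^ 2 := by
  simp only [szaszCoef, θ_mul_sub_sq]
  have i1 : Integrable (fun t => θ n k t * t ^ 2) (volume.restrict (Ioi 0)) :=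
    integrableOn_θ_mul_sq hn k
  have i2 := (integrableOn_θ_mul_id hn k).const_mul (2 * x)
  rw [integral_add (f := fun t => θ n k t * t ^ 2 - 2 * x * (θ n k t * t)) (i1.sub i2)
    ((integrableOn_θ hn k).mul_const _), integral_sub i1 i2, integral_const_mul,
    integral_mul_const, integral_θ hn, integral_θ_mul_id hn, integral_θ_mul_sq hn, one_mul]

/-- The mean of `t - x`. -/
theorem hasSum_wt_mul_szaszCoef_sub {c x : ℝ} {n : ℕ} (hc : 0 < c) (hx : 0 ≤ x) (hn : 0 < n)
    (r : ℕ) :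
    HasSum (fun k => wt c (n / c + r) k x * szaszCoef n (fun t => t - x) (k + r))
      ((r * c * x + r + 1) / n) := by
  have h := ((hasSum_nat_mul_wt (n / c + r) hc hx).mul_right (n : ℝ)⁻¹).add
    ((hasSum_wt (n / c + r) hc hx).mul_right ((r + 1) / n - x))
  convert! h using 1
  · ext k
    rw [szaszCoef_sub hn]
    push_cast
    field_simp
    ring
  · field_simp
    ring

/-- The second moment of `t - x`; the terms of order one cancel. -/
theorem hasSum_wt_mul_szaszCoef_sub_sq {c x : ℝ} {n : ℕ} (hc : 0 < c) (hx : 0 ≤ x) (hn : 0 < n)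
    (r : ℕ) :
    HasSum (fun k => wt c (n / c + r) k x * szaszCoef n (fun t => (t - x) ^ 2) (k + r))
      ((c * x ^ 2 + 2 * x) / n + (r * c * (r * c + c) * x ^ 2 + (2 * r + 4) * (r * c) * x +
        (r + 1) * (r + 2)) / n ^ 2) := by
  have h := (((hasSum_nat_sq_mul_wt (n / c + r) hc hx).mul_right ((n : ℝ) ^ 2)⁻¹).add
    ((hasSum_nat_mul_wt (n / c + r) hc hx).mul_right ((2 * r + 3) / n ^ 2 - 2 * x / n))).add
    ((hasSum_wt (n / c + r) hc hx).mul_right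
      ((r + 1) * (r + 2) / n ^ 2 - 2 * x * (r + 1) / n + x ^ 2))
  convert! h using 1
  · ext k
    rw [szaszCoef_sub_sq hn]
    push_cast
    field_simp
    ring
  · field_simp
    ring

/-- If `G` is close to an affine function in a weighted sense, the operator sends it close to the
value of that function at `x`; the mean and the variance about `x` are both of order `1 / n`. -/
theorem exists_abs_wtSum_szaszCoef_sub_le {c b₁ : ℝ} (hc : 0 < c) (hb₁ : 0 ≤ b₁) (r : ℕ) :
    ∃ C : ℝ, 0 ≤ C ∧ ∀ (n : ℕ) (x : ℝ) (G : ℝ → ℝ) (y m α β : ℝ), 0 < n → 0 ≤ x → x ≤ b₁ →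
      Continuous G → 0 ≤ β →
      (∀ t, 0 < t → |G t - (y + m * (t - x))| ≤ α + β * (t - x) ^ 2) →
      (Summable fun k => wt c (n / c + r) k x * szaszCoef n G (k + r)) ∧
      |wtSum c (n / c + r) (fun k => szaszCoef n G (k + r)) x - y| ≤
        α + C * (β + |m|) * (n : ℝ)⁻¹ := by
  set C₁ := r * c * b₁ + r + 1 with hC₁
  set C₂ := (c * b₁ ^ 2 + 2 * b₁) + (r * c * (r * c + c) * b₁ ^ 2 + (2 * r + 4) * (r * c) * b₁ +
        (r + 1) * (r + 2)) with hC₂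
  have hC₁0 : 0 ≤ C₁ := by positivity
  have hC₂0 : 0 ≤ C₂ := by positivity
  refine ⟨C₁ + C₂, by positivity, fun n x G y m α β hn hx hxb hG hβ hb => ?_⟩
  have hn' : (0 : ℝ) < n := by exact_mod_cast hn
  have hS : 0 ≤ (n : ℝ) / c + r := by positivity
  set D : ℝ → ℝ := fun t => G t - (y + m * (t - x)) with hD
  have iφ : ∀ k, IntegrableOn (fun t => θ n k t * (α + β * (t - x) ^ 2)) (Ioi 0) := fun k => by
    have e : ∀ t, θ n k t * (α + β * (t - x) ^ 2) =
      θ n k t * α + β * (θ n k t * (t - x) ^ 2) := fun t => by ring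
    simp only [e]
    exact ((integrableOn_θ hn k).mul_const α).add ((integrableOn_θ_mul_sub_sq hn x k).const_mul β)
  have sφ : ∀ k, szaszCoef n (fun t => α + β * (t - x) ^ 2) k =
      α + β * szaszCoef n (fun t => (t - x) ^ 2) k := fun k => by
    have e : ∀ t, θ n k t * (α + β * (t - x) ^ 2) =
      θ n k t * α + β * (θ n k t * (t - x) ^ 2) := fun t => by ring
    simp only [szaszCoef, e]
    rw [integral_add ((integrableOn_θ hn k).mul_const α)
      ((integrableOn_θ_mul_sub_sq hn x k).const_mul β), integral_mul_const, integral_const_mul,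
      integral_θ hn, one_mul]
  have hDc : Continuous D := by fun_prop
  have iD : ∀ k, IntegrableOn (fun t => θ n k t * D t) (Ioi 0) := fun k => by
    refine Integrable.mono' (iφ k) ((continuous_θ n k).mul hDc).aestronglyMeasurable ?_
    filter_upwards [ae_restrict_mem measurableSet_Ioi] with t ht
    have h0 := θ_nonneg n k (le_of_lt ht)
    rw [Real.norm_eq_abs, abs_mul, abs_of_nonneg h0]
    exact mul_le_mul_of_nonneg_left (hb t ht) h0
  have sG : ∀ k, szaszCoef n G k = (y + m * szaszCoef n (fun t => t - x) k) + szaszCoef n D k := by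
    intro k
    have e : ∀ t, θ n k t * G t = (θ n k t * y + m * (θ n k t * (t - x))) + θ n k t * D t :=
      fun t => by simp only [hD]; ring
    simp only [szaszCoef, e]
    rw [integral_add (f := fun t => θ n k t * y + m * (θ n k t * (t - x)))
      (((integrableOn_θ hn k).mul_const y).add
      ((integrableOn_θ_mul_sub hn x k).const_mul m)) (iD k),
      integral_add ((integrableOn_θ hn k).mul_const y)
        ((integrableOn_θ_mul_sub hn x k).const_mul m),
      integral_mul_const, integral_const_mul, integral_θ hn, one_mul]
  have hV := hasSum_wt_mul_szaszCoef_sub_sq hc hx hn r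
  have hE := hasSum_wt_mul_szaszCoef_sub hc hx hn r
  have h1 := hasSum_wt (n / c + r) hc hx
  obtain ⟨s1, b1⟩ := summable_and_abs_wtSum_le (A := fun k => szaszCoef n D (k + r)) hc hS hx
    (fun k => (abs_szaszCoef_le (k + r) (iφ (k + r)) hb).trans (sφ (k + r)).le)
    (((h1.mul_right α).add (hV.mul_left β)).congr_fun fun k => by ring)
  have hlin := (h1.mul_right y).add (hE.mul_left m)
  have htot := (hlin.add s1.hasSum).congr_fun (g := fun k =>
    wt c (n / c + r) k x * szaszCoef n G (k + r)) fun k => by rw [sG]; ring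
  refine ⟨htot.summable, ?_⟩
  rw [wtSum, htot.tsum_eq]
  change |1 * y + m * _ + wtSum c (n / c + r) (fun k => szaszCoef n D (k + r)) x - y| ≤ _
  have hE' : |m * ((r * c * x + r + 1) / n)| ≤ |m| * (C₁ * (n : ℝ)⁻¹) := by
    rw [abs_mul, abs_of_nonneg (by positivity : 0 ≤ (r * c * x + r + 1) / (n : ℝ)), div_eq_mul_inv,
      hC₁]
    gcongr
  have hV' : (c * x ^ 2 + 2 * x) / n + (r * c * (r * c + c) * x ^ 2 + (2 * r + 4) * (r * c) * x +
        (r + 1) * (r + 2)) / n ^ 2 ≤ C₂ * (n : ℝ)⁻¹ := by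
    have hi : ((n : ℝ) ^ 2)⁻¹ ≤ (n : ℝ)⁻¹ := by
      refine inv_anti₀ hn' ?_
      have : (1 : ℝ) ≤ n := by exact_mod_cast hn
      nlinarith
    rw [div_eq_mul_inv, div_eq_mul_inv, hC₂, add_mul (c * b₁ ^ 2 + 2 * b₁)]
    gcongr
  have hβV := mul_le_mul_of_nonneg_left hV' hβ
  have hm1 := mul_nonneg (abs_nonneg m) (mul_nonneg hC₂0 (inv_nonneg.2 hn'.le))
  have hm2 := mul_nonneg hβ (mul_nonneg hC₁0 (inv_nonneg.2 hn'.le))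
  have := abs_le.1 b1
  have := abs_le.1 hE'
  rw [abs_le]; constructor <;> linarith

/-- Exponential decay absorbs every power of `n`. -/
theorem exists_pow_mul_exp_neg_le (m : ℕ) {κ : ℝ} (hκ : 0 < κ) :
    ∃ C : ℝ, 0 ≤ C ∧ ∀ n : ℕ, (n : ℝ) ^ m * Real.exp (-(κ * n)) ≤ C := by
  refine ⟨m.factorial / κ ^ m, by positivity, fun n => ?_⟩
  have h := Real.pow_div_factorial_le_exp (κ * n) (by positivity) m
  rw [div_le_iff₀ (by positivity), mul_pow] at h
  rw [Real.exp_neg, ← div_eq_mul_inv, div_le_iff₀ (Real.exp_pos _), div_mul_eq_mul_div,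
    le_div_iff₀ (by positivity)]
  linarith

/-! ### The error estimate -/

/-- Beyond `[a, b]`, where the extended function is constant, the deviation from the affine function
is paid for by the quadratic term, since there `|t - x| ≥ δ`. -/
theorem abs_projIcc_sub_affine_le {g : ℝ → ℝ} {a b x y m ω P δ : ℝ} (hab : a ≤ b) (hδ : 0 < δ)
    (hω : 0 ≤ ω) (hP : 0 ≤ P) (hxa : a + δ ≤ x) (hxb : x + δ ≤ b)
    (hg : ∀ t ∈ Icc a b, |g t - (y + m * (t - x))| ≤ 4 * ω * (1 + P * (t - x) ^ 2)) (t : ℝ) :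
    |g (projIcc a b hab t) - (y + m * (t - x))| ≤
      4 * ω + (4 * ω * P + |m| / δ) * (t - x) ^ 2 := by
  have hmδ : 0 ≤ |m| / δ := by positivity
  -- the estimate for a projection `s` of `t` lying between `x` and `t`
  have key : ∀ s ∈ Icc a b, (s - x) ^ 2 ≤ (t - x) ^ 2 → |s - t| ≤ |t - x| → δ ≤ |t - x| →
      |g s - (y + m * (t - x))| ≤ 4 * ω + (4 * ω * P + |m| / δ) * (t - x) ^ 2 := by
    intro s hs h1 h2 h3
    have e1 := hg s hs
    have e2 : |m * (s - t)| ≤ |m| / δ * (t - x) ^ 2 := by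
      rw [abs_mul, div_mul_eq_mul_div, le_div_iff₀ hδ, mul_assoc, ← sq_abs (t - x), sq]
      gcongr
    have e3 : 4 * ω * P * (s - x) ^ 2 ≤ 4 * ω * P * (t - x) ^ 2 := by gcongr
    have e4 := abs_add_le (g s - (y + m * (s - x))) (m * (s - t))
    rw [show g s - (y + m * (s - x)) + m * (s - t) = g s - (y + m * (t - x)) by ring] at e4
    linarith
  rcases lt_or_ge t a with hta | hta
  · rw [projIcc_of_le_left hab hta.le]
    refine key a ⟨le_rfl, hab⟩ (by nlinarith) ?_ ?_
    · rw [abs_of_pos (by linarith), abs_of_neg (by linarith)]; linarith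
    · rw [abs_of_neg (by linarith)]; linarith
  rcases lt_or_ge b t with htb | htb
  · rw [projIcc_of_right_le hab htb.le]
    refine key b ⟨hab, le_rfl⟩ (by nlinarith) ?_ ?_
    · rw [abs_of_neg (by linarith), abs_of_pos (by linarith)]; linarith
    · rw [abs_of_pos (by linarith)]; linarith
  · rw [projIcc_of_mem hab ⟨hta, htb⟩]
    refine (hg t ⟨hta, htb⟩).trans ?_
    have : 0 ≤ |m| / δ * (t - x) ^ 2 := by positivity
    linarith

/-- The pointwise form of the error estimate. -/
theorem exists_abs_iteratedDeriv_L_sub_le {c : ℝ} (hc : 0 < c) (r : ℕ) {a a₁ b₁ b : ℝ}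
    (ha : 0 ≤ a) (haa₁ : a < a₁) (hab₁ : a₁ ≤ b₁) (hbb₁ : b₁ < b) :
    ∃ C : ℝ, 0 < C ∧ ∃ N : ℕ, 0 < N ∧ ∀ (f : ℝ → ℝ) (M : ℝ),
      AEStronglyMeasurable f (volume.restrict (Ioi (0 : ℝ))) → (∀ t, 0 ≤ t → |f t| ≤ M) →
      ContDiffOn ℝ r f (Icc a b) → ∀ n : ℕ, N ≤ n → ∀ x ∈ Icc a₁ b₁,
        |iteratedDeriv r (L c n f) x - iteratedDerivWithin r f (Icc a b) x| ≤
          C * ((n : ℝ)⁻¹ * M +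
            omega2 (iteratedDerivWithin r f (Icc a b)) ((n : ℝ) ^ (-(1 / 2) : ℝ)) a b) := by
  have hab : a < b := by linarith
  obtain ⟨δ, hδ, hδa, hδb⟩ : ∃ δ : ℝ, 0 < δ ∧ a + δ ≤ a₁ ∧ b₁ + δ ≤ b :=
    ⟨min (a₁ - a) (b - b₁), lt_min (by linarith) (by linarith),
      by linarith [min_le_left (a₁ - a) (b - b₁)], by linarith [min_le_right (a₁ - a) (b - b₁)]⟩
  obtain ⟨Cρ, hCρ, hρ⟩ := exists_abs_rising_sub_one_le hc r
  obtain ⟨Cm, hCm, hmom⟩ := exists_abs_wtSum_szaszCoef_sub_le hc (b₁ := b₁) (by linarith) r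
  obtain ⟨Ca, hCa, haff⟩ := exists_abs_affine_coeff_le r hab
  obtain ⟨Ce, hCe, hext⟩ := exists_abs_iteratedDeriv_le_mul_exp r ha hab
  obtain ⟨Ch, hCh, κ, hκ, N₁, hN₁, hloc⟩ :=
    exists_abs_wtSum_fwdDiff_le_exp_neg hc r ha haa₁ hab₁ hbb₁
  obtain ⟨Cp, hCp, hpow⟩ := exists_pow_mul_exp_neg_le (r + 1) hκ
  obtain ⟨N₂, hN₂⟩ := exists_nat_ge (1 / δ ^ 2)
  set CW := 4 * (1 + (b - a) ^ 2) with hCW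
  set Cy := Ca * (1 + CW) with hCy
  set CB := Cy * (1 + (b - a)) + CW with hCB
  set CK := 1 + Ce * (1 + CB) with hCK
  have hba : 0 < b - a := by linarith
  have hCW0 : 0 ≤ CW := by positivity
  have hCy0 : 0 ≤ Cy := by positivity
  have hCB0 : 0 ≤ CB := by positivity
  have hCe0 : 0 ≤ Ce := by linarith
  have hCK0 : 0 ≤ CK := by positivity
  set CD := (1 + Cρ) * (4 + Cm * (4 + (1 / δ + 1) * Cy)) + Cy * Cρ with hCD
  have hCD0 : 0 ≤ CD := by positivity
  refine ⟨CD + (1 + Cρ) * Ch * CK * Cp + 1, by positivity, max (max N₁ N₂) 2, by simp,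
    fun f M hf hM hfr n hn x hx => ?_⟩
  have hnN₁ : N₁ ≤ n := (le_max_left _ _).trans ((le_max_left _ _).trans hn)
  have hnN₂ : (N₂ : ℝ) ≤ n := by
    exact_mod_cast (le_max_right _ _).trans ((le_max_left _ _).trans hn)
  have hn2 : 2 ≤ n := (le_max_right _ _).trans hn
  have hn0 : 0 < n := by omega
  have hn1 : (1 : ℝ) < n := by exact_mod_cast hn2
  have hn' : (0 : ℝ) < n := by linarith
  have hx0 : 0 < x := by linarith [hx.1]
  have hxab : x ∈ Icc a b := ⟨by linarith [hx.1], by linarith [hx.2]⟩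
  set g := iteratedDerivWithin r f (Icc a b) with hg
  have hgc : ContinuousOn g (Icc a b) :=
    hfr.continuousOn_iteratedDerivWithin le_rfl (uniqueDiffOn_Icc hab)
  set η := (n : ℝ) ^ (-(1 / 2) : ℝ) with hη
  have hη0 : 0 < η := Real.rpow_pos_of_pos hn' _
  have hη2 : η ^ 2 = (n : ℝ)⁻¹ := by
    rw [hη, ← Real.rpow_natCast, ← Real.rpow_mul hn'.le]
    norm_num
    exact Real.rpow_neg_one _
  have hηδ : η ≤ δ := by
    refine (pow_le_pow_iff_left₀ hη0.le hδ.le two_ne_zero).1 ?_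
    rw [hη2]
    have := hN₂.trans hnN₂
    rw [div_le_iff₀ (by positivity)] at this
    rw [inv_le_iff_one_le_mul₀ hn']
    linarith
  set ω := omega2 g η a b with hω
  have hω0 : 0 ≤ ω := omega2_nonneg _ _ _ _
  have hM0 : 0 ≤ M := (abs_nonneg _).trans (hM 0 le_rfl)
  -- `Θ = n · (M / n + ω)` dominates all quantities derived from `f`
  set Θ := M + n * ω with hΘ
  have hΘ0 : 0 ≤ Θ := by positivity
  have hMΘ : M ≤ Θ := by rw [hΘ]; linarith [mul_nonneg hn'.le hω0]
  have hE : (n : ℝ)⁻¹ * M + ω = Θ * (n : ℝ)⁻¹ := by rw [hΘ]; field_simp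
  obtain ⟨m, hm⟩ := exists_slope_abs_sub_le hgc hη0 (x := x) (by linarith [hx.1])
    (by linarith [hx.2])
  have hm' : ∀ t ∈ Icc a b, |g t - (g x + m * (t - x))| ≤ 4 * ω * (1 + n * (t - x) ^ 2) := by
    intro t ht
    have := hm t ht
    rwa [div_pow, hη2, div_inv_eq_mul, mul_comm ((t - x) ^ 2)] at this
  have hW : ∀ t ∈ Icc a b, |g t - (g x + m * (t - x))| ≤ CW * Θ := by
    intro t ht
    refine (hm' t ht).trans ?_
    have h1 : (t - x) ^ 2 ≤ (b - a) ^ 2 := by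
      refine sq_le_sq' ?_ ?_ <;> linarith [ht.1, ht.2, hxab.1, hxab.2]
    calc 4 * ω * (1 + n * (t - x) ^ 2) ≤ 4 * ω * (n + n * (b - a) ^ 2) := by gcongr
      _ = CW * (n * ω) := by rw [hCW]; ring
      _ ≤ CW * Θ := by gcongr; linarith
  have hMab : ∀ t ∈ Icc a b, |f t| ≤ M := fun t ht => hM t (ha.trans ht.1)
  obtain ⟨hyb, hmb⟩ : |g x| ≤ Cy * Θ ∧ |m| ≤ Cy * Θ := by
    have h := haff f M (CW * Θ) x (g x) m hfr hMab hxab hW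
    have e : Ca * (M + CW * Θ) ≤ Cy * Θ := by
      rw [hCy, mul_assoc Ca]
      refine mul_le_mul_of_nonneg_left ?_ hCa
      linarith
    exact ⟨h.1.trans e, h.2.trans e⟩
  have hgB : ∀ t ∈ Icc a b, |g t| ≤ CB * Θ := by
    intro t ht
    have h1 := hW t ht
    have h2 : |m * (t - x)| ≤ Cy * Θ * (b - a) := by
      rw [abs_mul]
      refine mul_le_mul hmb ?_ (abs_nonneg _) (by positivity)
      rw [abs_le]; constructor <;> linarith [ht.1, ht.2, hxab.1, hxab.2]
    have h3 := abs_le.1 h1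
    have h4 := abs_le.1 h2
    have h5 := abs_le.1 hyb
    rw [hCB, abs_le]; constructor <;> linarith
  obtain ⟨F, hF, hFf, hFr⟩ := exists_contDiff_extension r hab hfr
  set G := iteratedDeriv r F with hG
  have hGB : ∀ t, 0 ≤ t → |G t| ≤ CB * Θ * Real.exp t := fun t ht => by
    rw [hFr]
    exact (hgB _ (projIcc a b hab.le t).2).trans
      (le_mul_of_one_le_right (by positivity) (Real.one_le_exp ht))
  have hFexp : ∀ j ≤ r, ∀ t, 0 < t →
      |iteratedDeriv j F t| ≤ Ce * (1 + CB) * Θ * Real.exp (1 * t) := by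
    intro j hj t ht
    have h := hext F M (CB * Θ) hF (fun t ht => by rw [hFf ht]; exact hMab t ht) hGB j hj t ht.le
    have hle : M + CB * Θ ≤ (1 + CB) * Θ := by linarith
    refine h.trans ?_
    rw [one_mul, mul_assoc Ce (1 + CB)]
    gcongr
  have hfb : ∀ t, 0 < t → |f t| ≤ M * Real.exp (0 * t) := fun t ht => by
    simpa using hM t ht.le
  have iF : ∀ k, IntegrableOn (fun t => θ n k t * F t) (Ioi 0) := fun k =>
    integrableOn_θ_mul k hn1 hF.continuous.aestronglyMeasurable (by
      simpa using hFexp 0 (Nat.zero_le r))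
  have i_f : ∀ k, IntegrableOn (fun t => θ n k t * f t) (Ioi 0) := fun k =>
    integrableOn_θ_mul k hn' hf hfb
  set h : ℝ → ℝ := fun t => f t - F t with hh
  have hh0 : ∀ t ∈ Icc a b, h t = 0 := fun t ht => by simp [hh, hFf ht]
  have hhK : ∀ t, 0 < t → |h t| ≤ CK * Θ * Real.exp t := fun t ht => by
    have h1 := hFexp 0 (Nat.zero_le r) t ht
    rw [iteratedDeriv_zero, one_mul] at h1
    have h2 : M ≤ Θ * Real.exp t :=
      hMΘ.trans (le_mul_of_one_le_right hΘ0 (Real.one_le_exp ht.le))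
    have h3 := abs_sub (f t) (F t)
    have h4 := hM t ht.le
    rw [hCK]
    simp only [hh]
    linarith
  have hsplit : szaszCoef n f = szaszCoef n F + szaszCoef n h := by
    ext k
    simp only [szaszCoef, hh, mul_sub, Pi.add_apply]
    rw [integral_sub (i_f k) (iF k)]
    ring
  have hΔF := fwdDiff_iterate_szaszCoef hn0 hn1 r hF hFexp
  obtain ⟨sh, bh⟩ := hloc n hnN₁ h (CK * Θ) hh0 hhK x hx
  have hGdev : ∀ t, 0 < t → |G t - (g x + m * (t - x))| ≤
      4 * ω + (4 * ω * n + |m| / δ) * (t - x) ^ 2 := fun t _ => by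
    rw [hFr]
    exact abs_projIcc_sub_affine_le hab.le hδ hω0 hn'.le (by linarith [hx.1]) (by linarith [hx.2])
      hm' t
  obtain ⟨sG, bG⟩ := hmom n x G (g x) m (4 * ω) (4 * ω * n + |m| / δ) hn0 hx0.le hx.2
    (hF.continuous_iteratedDeriv r le_rfl) (by positivity) hGdev
  set T := wtSum c (n / c + r) (fun k => szaszCoef n G (k + r)) x with hT
  set R := wtSum c (n / c + r) ((fwdDiff 1)^[r] (szaszCoef n h)) x with hR
  set u := c ^ r * rising (n / c) r * ((n : ℝ) ^ r)⁻¹ with hu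
  have hu1 := hρ n hn0
  have hval : iteratedDeriv r (L c n f) x = u * T + (n : ℝ) ^ r * u * R := by
    rw [L_eq_wtSum, iteratedDeriv_wtSum hc (by positivity)
      (fun k => abs_szaszCoef_le_of_bounded hn0 k fun t ht => hM t ht.le) r hx0]
    have hsum : wtSum c (n / c + r) ((fwdDiff 1)^[r] (szaszCoef n f)) x =
        ((n : ℝ) ^ r)⁻¹ * T + R := by
      rw [hsplit, fwdDiff_iter_add]
      simp only [wtSum, Pi.add_apply, mul_add, hΔF, hT, hR]
      rw [Summable.tsum_add _ sh, ← tsum_mul_left]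
      · congr 2
        ext k; ring
      · exact (sG.mul_left ((n : ℝ) ^ r)⁻¹).congr fun k => by ring
    rw [hsum, hu]
    have : (n : ℝ) ^ r ≠ 0 := by positivity
    field_simp
  have hninv : 0 < (n : ℝ)⁻¹ := by positivity
  have hninv1 : (n : ℝ)⁻¹ ≤ 1 := inv_le_one_of_one_le₀ hn1.le
  set E := Θ * (n : ℝ)⁻¹ with hEdef
  have hE0 : 0 ≤ E := by positivity
  have hωE : ω ≤ E := by rw [← hE]; linarith [mul_nonneg hninv.le hM0]
  have hρpos : 0 ≤ u := by
    have := rising_nonneg (by positivity : 0 ≤ (n : ℝ) / c) r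
    positivity
  have hu2 : u ≤ 1 + Cρ := by
    have h1 := (abs_le.1 hu1).2
    have h2 : Cρ * (n : ℝ)⁻¹ ≤ Cρ * 1 := by gcongr
    linarith
  have hTy : |T - g x| ≤ (4 + Cm * (4 + (1 / δ + 1) * Cy)) * E := by
    have h1 : (4 * ω * n + |m| / δ + |m|) * (n : ℝ)⁻¹ ≤ (4 + (1 / δ + 1) * Cy) * E := by
      have e1 : (4 * ω * n + |m| / δ + |m|) * (n : ℝ)⁻¹ =
          4 * ω + (1 / δ + 1) * (|m| * (n : ℝ)⁻¹) := by
        field_simp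
        ring
      have e2 : (1 / δ + 1) * (|m| * (n : ℝ)⁻¹) ≤ (1 / δ + 1) * (Cy * Θ * (n : ℝ)⁻¹) := by gcongr
      rw [e1, hEdef]
      rw [hEdef] at hωE
      linarith
    have h2 := mul_le_mul_of_nonneg_left h1 hCm
    linarith
  have hR' : (n : ℝ) ^ r * |R| ≤ Ch * CK * Cp * E := by
    calc (n : ℝ) ^ r * |R| ≤ (n : ℝ) ^ r * (Ch * (CK * Θ) * Real.exp (-(κ * n))) := by gcongr
      _ = Ch * CK * ((n : ℝ) ^ (r + 1) * Real.exp (-(κ * n))) * E := by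
          rw [hEdef, pow_succ]; field_simp
      _ ≤ Ch * CK * Cp * E := by gcongr; exact hpow n
  have h1 : |u * (T - g x)| ≤ (1 + Cρ) * ((4 + Cm * (4 + (1 / δ + 1) * Cy)) * E) := by
    rw [abs_mul, abs_of_nonneg hρpos]
    gcongr
  have h2 : |(u - 1) * g x| ≤ Cy * Cρ * E := by
    rw [abs_mul]
    calc |u - 1| * |g x| ≤ (Cρ * (n : ℝ)⁻¹) * (Cy * Θ) := by gcongr
      _ = _ := by rw [hEdef]; ring
  have h3 : |(n : ℝ) ^ r * u * R| ≤ (1 + Cρ) * (Ch * CK * Cp * E) := by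
    rw [abs_mul, abs_of_nonneg (by positivity), mul_comm _ u, mul_assoc]
    gcongr
  rw [hE, hval, show u * T + (n : ℝ) ^ r * u * R - g x =
    u * (T - g x) + (u - 1) * g x + (n : ℝ) ^ r * u * R by ring]
  have h4 := abs_add_le (u * (T - g x) + (u - 1) * g x) ((n : ℝ) ^ r * u * R)
  have h5 := abs_add_le (u * (T - g x)) ((u - 1) * g x)
  rw [hCD]
  linarith

end HybridOp

theorem mainTheorem3 (c : ℝ) (hc : 0 < c) (r : ℕ) (a a₁ b₁ b : ℝ)
    (ha : 0 ≤ a) (haa₁ : a < a₁) (hab₁ : a₁ ≤ b₁) (hbb₁ : b₁ < b) :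
    ∃ C : ℝ, 0 < C ∧ ∃ N : ℕ, ∀ f : ℝ → ℝ,
      AEStronglyMeasurable f (volume.restrict (Ici (0 : ℝ))) →
      BddAbove ((fun t => |f t|) '' Ici (0 : ℝ)) →
      ContDiffOn ℝ (r : WithTop ℕ∞) f (Icc a b) →
      ∀ n : ℕ, N ≤ n →
        (∀ k : ℕ, IntegrableOn (fun t => HybridOp.θ n k t * f t) (Ioi (0 : ℝ))) ∧
        (∀ x : ℝ, 0 ≤ x →
          Summable fun k : ℕ =>
            HybridOp.p c n k x * ∫ t in Ioi (0 : ℝ), HybridOp.θ n k t * f t) ∧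
        ContDiffOn ℝ (r : WithTop ℕ∞) (HybridOp.L c n f) (Ioi (0 : ℝ)) ∧
        HybridOp.supNorm (Icc a₁ b₁)
            (fun x => iteratedDeriv r (HybridOp.L c n f) x
              - iteratedDerivWithin r f (Icc a b) x) ≤
          C * ((n : ℝ)⁻¹ * HybridOp.supNorm (Ici (0 : ℝ)) f
            + HybridOp.omega2 (iteratedDerivWithin r f (Icc a b))
                ((n : ℝ) ^ (-(1 / 2) : ℝ)) a b) := by
  obtain ⟨C, hC, N, hN, h⟩ := HybridOp.exists_abs_iteratedDeriv_L_sub_le hc r ha haa₁ hab₁ hbb₁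
  refine ⟨C, hC, N, fun f hf hbdd hfr n hn => ?_⟩
  have hn0 : 0 < n := hN.trans_le hn
  have hf' : AEStronglyMeasurable f (volume.restrict (Ioi (0 : ℝ))) :=
    hf.mono_measure (Measure.restrict_mono Ioi_subset_Ici_self le_rfl)
  have hM : ∀ t, 0 ≤ t → |f t| ≤ HybridOp.supNorm (Ici 0) f := fun t ht =>
    le_csSup hbdd ⟨t, ht, rfl⟩
  have hcoef : ∀ k, |HybridOp.szaszCoef n f k| ≤ HybridOp.supNorm (Ici 0) f := fun k =>
    HybridOp.abs_szaszCoef_le_of_bounded hn0 k fun t ht => hM t ht.le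
  have hS : 0 ≤ (n : ℝ) / c := by positivity
  -- `p c n k` and `L c n f` are by definition the weights and their sum at parameter `n / c`
  refine ⟨fun k => ?_, fun x hx => HybridOp.summable_wt_mul hc hS hx hcoef,
    HybridOp.contDiffOn_wtSum hc hS hcoef r, ?_⟩
  · exact HybridOp.integrableOn_θ_mul (l := 0) k (by exact_mod_cast hn0) hf'
      (fun t ht => by simpa using hM t ht.le)
  · have hM0 := (abs_nonneg _).trans (hM 0 le_rfl)
    have hω := HybridOp.omega2_nonneg (iteratedDerivWithin r f (Icc a b))
      ((n : ℝ) ^ (-(1 / 2) : ℝ)) a b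
    refine Real.sSup_le ?_ (by positivity)
    rintro _ ⟨x, hx, rfl⟩
    exact h f _ hf' hM hfr n hn x hx
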